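/- Let $d\ge 3$. Consider bond percolation on $\mathbb{Z}^d$ with parameter $p\in[0,1]$: the nearest-neighbour edges are independently open with probability $p$ and closed with probability $1-p$, with law $\mathbb{P}_p$. Let $p_c=p_c(d)$ be the infimum of the $p\in[0,1]$ such that $\mathbb{P}_p(\text{there is an infinite open cluster})>0$. Each edge $e$ has a dual plaquette $\pi(e)$, namely the unique $(d-1)$-dimensional face of the lattice $\mathbb{Z}^d+(\tfrac12,\dots,\tfrac12)$ with the same centre as $e$; $\pi(e)$ is called open if and only if $e$ is closed. Two distinct plaquettes are adjacent if they share a $(d-2)$-dimensional face. A surface is a set of plaquettes that is connected for this adjacency relation and such that every $(d-2)$-dimensional face lies in an even number of its plaquettes. Let $p_{\mathrm{surf}}=p_{\mathrm{surf}}(d)$ be the critical point for the existence of an infinite surface all of whose plaquettes are open, that is, the supremum of the $p\in[0,1]$ such that $\mathbb{P}_p$-almost surely there is such a surface (it exists with probability $1$ for $p<p_{\mathrm{surf}}$ and with probability $0$ for $p>p_{\mathrm{surf}}$). Then $p_c\le p_{\mathrm{surf}}$. Moreover, for every $p\in[0,1]$ with $p<p_c$, there is $\mathbb{P}_p$-almost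 surely an infinite surface of open plaquettes. -/

import Mathlib

open MeasureTheory

namespace PlaquettePercolation

/-- A facet of `ℤ^d`: the set `x + (A₁ × ⋯ × A_d)`, where `A_i = {0,1}` for `i ∈ dirs` and
`A_i = {0}` for `i ∉ dirs`, and `x` is the vector `base`. The pair `(base, dirs)` is determined
by the set of points. -/
@[ext]
structure Facet (d : ℕ) where
  base : Fin d → ℤ
  dirs : Finset (Fin d)

namespace Facet

variable {d : ℕ}

/-- The set of points `x + (A₁ × ⋯ × A_d)`. -/
def points (F : Facet d) : Set (Fin d → ℤ) :=
  {z | ∀ i, z i = F.base i ∨ (i ∈ F.dirs ∧ z i = F.base i + 1)}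

/-- The number of factors equal to `{0,1}`. -/
def dim (F : Facet d) : ℕ := F.dirs.card

/-- Two facets of different dimensions are incident if one is a subset of the other. -/
def Incident (F G : Facet d) : Prop :=
  F.dim ≠ G.dim ∧ (F.points ⊆ G.points ∨ G.points ⊆ F.points)

/-- The dual of a facet. Facets of the shifted lattice `ℤ^d + h`, `h = (1/2, …, 1/2)`, are encoded
by their translates by `-h`, which are facets of `ℤ^d`. In true coordinates, the dual of
`x + (A₁ × ⋯ × A_d)` is obtained by replacing each factor `{0,1}` with `{1/2}` and each factor `{0}`
with `{-1/2, 1/2}`; after translation by `-h` these become `{0}` and `{-1, 0}`. -/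
def dual (F : Facet d) : Facet d where
  base i := if i ∈ F.dirs then F.base i else F.base i - 1
  dirs := F.dirsᶜ

theorem dim_dual_add_dim (F : Facet d) : F.dual.dim + F.dim = d := by
  have h := Finset.card_compl_add_card F.dirs
  rw [Fintype.card_fin] at h
  exact h

end Facet

/-- The edges of `ℤ^d`, that is, its `1`-facets. -/
abbrev Edge (d : ℕ) : Type := {F : Facet d // F.dim = 1}

/-- The plaquettes, that is, the `(d-1)`-facets of the shifted lattice `ℤ^d + h`
(encoded by their translates by `-h`). -/
abbrev Plaquette (d : ℕ) : Type := {F : Facet d // F.dim + 1 = d}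

/-- The plaquette `π(e)` dual to the edge `e`. -/
def dualPlaquette {d : ℕ} (e : Edge d) : Plaquette d :=
  ⟨e.1.dual, by have h := e.1.dim_dual_add_dim; rwa [e.2] at h⟩

/-- Configurations; the edge `e` is open if `ω e = true` and closed if `ω e = false`. -/
abbrev Config (d : ℕ) : Type := Edge d → Bool

/-- Product measure with parameter `p`: edges are independently open with probability `p`. -/
noncomputable def bondMeasure (d : ℕ) (p : unitInterval) : Measure (Config d) :=
  Measure.infinitePi fun _ : Edge d => ProbabilityTheory.bernoulliMeasure true false p

/-- The graph `(ℤ^d, η(ω))` formed by the open edges. -/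
def openGraph {d : ℕ} (ω : Config d) : SimpleGraph (Fin d → ℤ) where
  Adj x y := x ≠ y ∧ ∃ e : Edge d, ω e = true ∧ e.1.points = {x, y}
  symm := ⟨fun x y ⟨hne, e, he, hp⟩ => ⟨hne.symm, e, he, by rw [hp, Set.pair_comm]⟩⟩
  loopless := ⟨fun _ h => h.1 rfl⟩

/-- The vertex set of the open cluster of `x`. -/
def openCluster {d : ℕ} (ω : Config d) (x : Fin d → ℤ) : Set (Fin d → ℤ) :=
  {y | (openGraph ω).Reachable x y}

/-- There is an infinite open cluster. -/
def HasInfiniteCluster {d : ℕ} (ω : Config d) : Prop :=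
  ∃ x, (openCluster ω x).Infinite

/-- The critical probability `p_c(d)` of bond percolation: the infimum of the `p ∈ [0,1]` for which
an infinite open cluster exists with strictly positive probability. -/
noncomputable def pc (d : ℕ) : ℝ :=
  sInf {p : ℝ | ∃ q : unitInterval, (q : ℝ) = p ∧ 0 < bondMeasure d q {ω | HasInfiniteCluster ω}}

/-- Two distinct plaquettes are adjacent if some `(d-2)`-facet is incident to both. -/
def plaquetteGraph (d : ℕ) : SimpleGraph (Plaquette d) where
  Adj π₁ π₂ := π₁ ≠ π₂ ∧ ∃ f : Facet d, f.dim + 2 = d ∧ f.Incident π₁.1 ∧ f.Incident π₂.1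
  symm := ⟨fun _ _ ⟨hne, f, hf, h₁, h₂⟩ => ⟨hne.symm, f, hf, h₂, h₁⟩⟩
  loopless := ⟨fun _ h => h.1 rfl⟩

/-- The boundary of a set of plaquettes: the `(d-2)`-facets incident to an odd number of its
elements (every `(d-2)`-facet is incident to finitely many plaquettes). -/
def boundary {d : ℕ} (P : Set (Plaquette d)) : Set (Facet d) :=
  {f | f.dim + 2 = d ∧ Odd {π | π ∈ P ∧ f.Incident π.1}.ncard}

/-- A surface is a connected set of plaquettes with empty boundary. -/
def IsSurface {d : ℕ} (P : Set (Plaquette d)) : Prop :=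
  ((plaquetteGraph d).induce P).Connected ∧ boundary P = ∅

/-- A plaquette is open if its dual edge is closed. -/
def PlaquetteOpen {d : ℕ} (ω : Config d) (π : Plaquette d) : Prop :=
  ∃ e : Edge d, dualPlaquette e = π ∧ ω e = false

/-- There is an infinite surface all of whose plaquettes are open. -/
def HasInfiniteOpenSurface {d : ℕ} (ω : Config d) : Prop :=
  ∃ P : Set (Plaquette d), P.Infinite ∧ IsSurface P ∧ ∀ π ∈ P, PlaquetteOpen ω π

/-- The critical probability `p_surf(d)`: the supremum of the `p ∈ [0,1]` for which an infinite open
surface exists almost surely. (An infinite open surface exists with probability `1` for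
`p < p_surf(d)` and with probability `0` for `p > p_surf(d)`, which determines `p_surf(d)`.) -/
noncomputable def psurf (d : ℕ) : ℝ :=
  sSup {p : ℝ | ∃ q : unitInterval, (q : ℝ) = p ∧ ∀ᵐ ω ∂bondMeasure d q, HasInfiniteOpenSurface ω}

end PlaquettePercolation

namespace PlaquettePercolation

variable {d : ℕ}

/-! Below `pc` open clusters have finite expected size, so far-out points of two different
coordinate axes lie in different clusters. Separating the two axes then forces an infinite closed
interface.

Probabilistic half. Let `phi S u t` be `t` times the expected number of boundary edges of `S` whose
inner end is joined to `u` inside `S`. If `phi S 0 p ≥ 1` for every finite `S` containing 0, Russo's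
formula gives a differential inequality (`prob_mem_confined_le`), which makes the cluster of 0
infinite with positive probability at every `q > p` in the unit interval. Hence `p < pc` yields some
`S` with `phi S 0 p < 1` (`exists_phi_lt_one`). Iterating the Simon–Lieb inequality `prob_connIn_le`
over translates of `S` bounds the expected cluster size (`tsum_measure_conn_ne_top`). The
differences of points on two axes are distinct, so Borel–Cantelli shows that the tails of the two
axes are almost surely not connected (`ae_exists_rays_not_connected`).

Topological half. Let `A` be the union of the clusters meeting the tail of one axis. All edges
between `A` and its complement are closed, so the dual plaquettes, `cut A`, are open. They have
empty boundary, because membership in `A` changes an even number of times around a unit square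
(`boundary_cut`), and each component is again a surface (`isSurface_componentIn`). If all components
were finite, a mod 2 Stokes argument in the quadrant spanned by the two axes would put their tails
on the same side of `A` (`exists_infinite_componentIn_cut`). So some component is infinite.

The inequality between critical points follows from the almost sure statement by comparing the
infimum and the supremum. -/

instance (p : unitInterval) : IsProbabilityMeasure (bondMeasure d p) := by
  unfold bondMeasure; infer_instance

/-! ### Events determined by finitely many edges, and independence -/

/-- The event `A` is determined by the states of the edges in `F`. -/
def DeterminedBy (A : Set (Config d)) (F : Set (Edge d)) : Prop :=
  ∀ ⦃ω ω' : Config d⦄, (∀ e ∈ F, ω e = ω' e) → ω ∈ A → ω' ∈ A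

namespace DeterminedBy

variable {A B : Set (Config d)} {F G : Set (Edge d)}

theorem mem_iff (h : DeterminedBy A F) {ω ω' : Config d} (hω : ∀ e ∈ F, ω e = ω' e) :
    ω ∈ A ↔ ω' ∈ A :=
  ⟨h hω, h fun e he => (hω e he).symm⟩

theorem mono (h : DeterminedBy A F) (hFG : F ⊆ G) : DeterminedBy A G :=
  fun _ _ hω => h fun e he => hω e (hFG he)

theorem inter (hA : DeterminedBy A F) (hB : DeterminedBy B F) : DeterminedBy (A ∩ B) F :=
  fun _ _ hω h => ⟨hA hω h.1, hB hω h.2⟩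

/-- Pass from `ω` to `ω'` through the configuration equal to `ω` on `F` and to `ω'` elsewhere: the
first change is invisible to `F`, the second to `G`. -/
theorem inter_right (hF : DeterminedBy A F) (hG : DeterminedBy A G) :
    DeterminedBy A (F ∩ G) := by
  classical
  intro ω ω' hω h
  have h1 : (fun e => if e ∈ F then ω e else ω' e) ∈ A :=
    hF (fun e he => by simp [he]) h
  refine hG (fun e he => ?_) h1
  by_cases heF : e ∈ F
  · simp [heF, hω e ⟨heF, he⟩]
  · simp [heF]

theorem exists_preimage (h : DeterminedBy A F) :
    ∃ T : Set (F → Bool), A = (fun ω (e : F) => ω e) ⁻¹' T := by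
  refine ⟨(fun ω (e : F) => ω e) '' A, Set.Subset.antisymm (Set.subset_preimage_image _ _) ?_⟩
  rintro ω ⟨ω', hω', heq⟩
  exact h (fun e he => congrFun heq ⟨e, he⟩) hω'

theorem measurableSet (h : DeterminedBy A F) (hF : F.Finite) : MeasurableSet A := by
  obtain ⟨T, rfl⟩ := h.exists_preimage
  have := hF.to_subtype
  exact (measurable_pi_lambda _ fun _ => measurable_pi_apply _) (Set.toFinite T).measurableSet

theorem measure_inter (p : unitInterval) (hA : DeterminedBy A F) (hB : DeterminedBy B G)
    (hF : F.Finite) (hG : G.Finite) (hFG : Disjoint F G) :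
    bondMeasure d p (A ∩ B) = bondMeasure d p A * bondMeasure d p B := by
  lift F to Finset (Edge d) using hF
  lift G to Finset (Edge d) using hG
  have hind : ProbabilityTheory.iIndepFun (fun (e : Edge d) (ω : Config d) => ω e)
      (bondMeasure d p) :=
    ProbabilityTheory.iIndepFun_infinitePi (X := fun _ b => b) (fun _ => measurable_id)
  have h := hind.indepFun_finset F G (by simpa using hFG) (fun e => measurable_pi_apply e)
  obtain ⟨T, rfl⟩ := hA.exists_preimage
  obtain ⟨T', rfl⟩ := hB.exists_preimage
  exact h.measure_inter_preimage_eq_mul T T' (Set.toFinite T).measurableSet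
    (Set.toFinite T').measurableSet

end DeterminedBy

/-! ### Conditioning on an edge, and Russo's formula -/

theorem bondMeasure_open (p : unitInterval) (e : Edge d) :
    bondMeasure d p {ω | ω e = true} = ENNReal.ofReal p := by
  have h : bondMeasure d p ((fun ω => ω e) ⁻¹' {true}) = _ :=
    (measurePreserving_eval_infinitePi (μ := fun _ : Edge d =>
      ProbabilityTheory.bernoulliMeasure true false p) e).measure_preimage
      (MeasurableSet.singleton true).nullMeasurableSet
  refine h.trans ?_
  rw [ProbabilityTheory.bernoulliMeasure_apply_of_mem_of_notMem p (.singleton true) (by simp)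
    (by simp)]
  rw [ENNReal.ofReal]
  congr 1
  exact (Real.toNNReal_of_nonneg p.2.1).symm

theorem determinedBy_open (e : Edge d) (b : Bool) : DeterminedBy {ω | ω e = b} {e} :=
  fun ω ω' h hω => by rw [Set.mem_ofPred_eq] at *; rw [← h e rfl, hω]

open Classical in
theorem DeterminedBy.update {A : Set (Config d)} {F : Set (Edge d)} (h : DeterminedBy A F)
    (e : Edge d) (b : Bool) : DeterminedBy {ω | Function.update ω e b ∈ A} (F \ {e}) := by
  intro ω ω' hω hA
  refine h (fun e' he' => ?_) hA
  by_cases hee : e' = e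
  · subst hee; simp
  · simpa [hee] using hω e' ⟨he', hee⟩

open Classical in
/-- Conditioning on the state of one edge. -/
theorem real_eq_update (p : unitInterval) {A : Set (Config d)} {F : Set (Edge d)}
    (hF : F.Finite) (h : DeterminedBy A F) (e : Edge d) :
    (bondMeasure d p).real A = p * (bondMeasure d p).real {ω | Function.update ω e true ∈ A} +
      (1 - p) * (bondMeasure d p).real {ω | Function.update ω e false ∈ A} := by
  have hopen : (bondMeasure d p).real {ω | ω e = true} = p := by
    rw [Measure.real, bondMeasure_open, ENNReal.toReal_ofReal p.2.1]
  have hclosed : (bondMeasure d p).real {ω | ω e = false} = 1 - p := by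
    have : {ω : Config d | ω e = false} = {ω | ω e = true}ᶜ := by ext; simp
    rw [this, probReal_compl_eq_one_sub
      ((determinedBy_open e true).measurableSet (Set.finite_singleton e)), hopen]
  have key (b : Bool) : (bondMeasure d p).real (A ∩ {ω | ω e = b}) =
      (bondMeasure d p).real {ω | ω e = b} *
        (bondMeasure d p).real {ω | Function.update ω e b ∈ A} := by
    have : A ∩ {ω | ω e = b} = {ω | ω e = b} ∩ {ω | Function.update ω e b ∈ A} := by
      ext ω
      simp only [Set.mem_inter_iff, Set.mem_ofPred_eq]
      constructor
      · rintro ⟨h1, rfl⟩; simpa using h1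
      · rintro ⟨rfl, h1⟩; simpa using h1
    rw [this, Measure.real, DeterminedBy.measure_inter p (determinedBy_open e b) (h.update e b)
      (Set.finite_singleton e) (hF.subset Set.sdiff_subset) Set.disjoint_sdiff_right,
      ENNReal.toReal_mul]
    rfl
  have hdiff : A \ {ω | ω e = true} = A ∩ {ω | ω e = false} := by ext; simp
  rw [← measureReal_inter_add_sdiff
    ((determinedBy_open e true).measurableSet (Set.finite_singleton e)), hdiff, key, key, hopen,
    hclosed]

/-- The probability of `A` as a function of a real parameter. -/
noncomputable def prob (A : Set (Config d)) (t : ℝ) : ℝ :=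
  (bondMeasure d (Set.projIcc 0 1 zero_le_one t)).real A

open Classical in
/-- Russo's formula. -/
theorem hasDerivWithinAt_prob {A : Set (Config d)} {F : Finset (Edge d)}
    (h : DeterminedBy A F) {t : ℝ} (ht : t ∈ Set.Icc (0 : ℝ) 1) :
    HasDerivWithinAt (prob A) (∑ e ∈ F, (prob {ω | Function.update ω e true ∈ A} t -
      prob {ω | Function.update ω e false ∈ A} t)) (Set.Icc 0 1) t := by
  induction F using Finset.induction_on generalizing A with
  | empty =>
    have hA : A = ∅ ∨ A = Set.univ := by
      rcases A.eq_empty_or_nonempty with h0 | ⟨ω, hω⟩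
      · exact .inl h0
      · exact .inr (Set.eq_univ_of_forall fun ω' => h (by simp) hω)
    rcases hA with rfl | rfl
    · have : prob (∅ : Set (Config d)) = fun _ => 0 := by ext; simp [prob]
      rw [this]
      simpa using hasDerivWithinAt_const t (Set.Icc (0:ℝ) 1) (0 : ℝ)
    · have : prob (Set.univ : Set (Config d)) = fun _ => 1 := by ext; simp [prob]
      rw [this]
      simpa using hasDerivWithinAt_const t (Set.Icc (0:ℝ) 1) (1 : ℝ)
  | insert e F he ih =>
    have hsplit (B : Set (Config d)) {G : Set (Edge d)} (hG : G.Finite) (hB : DeterminedBy B G)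
        {s : ℝ} (hs : s ∈ Set.Icc (0 : ℝ) 1) :
        prob B s = s * prob {ω | Function.update ω e true ∈ B} s +
          (1 - s) * prob {ω | Function.update ω e false ∈ B} s := by
      have := real_eq_update ⟨s, hs⟩ hG hB e
      simpa only [prob, Set.projIcc_of_mem _ hs] using this
    have hupd (b : Bool) : DeterminedBy {ω | Function.update ω e b ∈ A} (F : Set (Edge d)) := by
      refine (h.update e b).mono ?_
      intro x hx
      have := hx.1
      have hne := hx.2
      simp only [Finset.coe_insert, Set.mem_insert_iff, Set.mem_singleton_iff] at this hne
      exact this.resolve_left hne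
    -- Differentiate `s * prob A₁ s + (1 - s) * prob A₀ s`, where `A₁`, `A₀` are `A` with `e` forced
    -- open or closed. The factors `s` and `1 - s` give the term of `e`; the induction hypothesis
    -- gives the others, once these are conditioned on `e` as well.
    have h1 := ih (hupd true)
    have h0 := ih (hupd false)
    have hd := ((hasDerivWithinAt_id t _).mul h1).add
      (((hasDerivWithinAt_const t _ (1:ℝ)).sub (hasDerivWithinAt_id t _)).mul h0)
    refine (hd.congr (fun s hs => hsplit A (Finset.finite_toSet _) h hs)
      (hsplit A (Finset.finite_toSet _) h ht)).congr_deriv ?_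
    rw [Finset.sum_insert he]
    have hterm (e' : Edge d) (he' : e' ∈ F) (b : Bool) :
        prob {ω | Function.update ω e' b ∈ A} t =
          t * prob {ω | Function.update ω e' b ∈ {ω | Function.update ω e true ∈ A}} t +
          (1 - t) * prob {ω | Function.update ω e' b ∈ {ω | Function.update ω e false ∈ A}} t := by
      rw [hsplit _ ((Finset.finite_toSet _).subset Set.sdiff_subset) (h.update e' b) ht]
      have hne : e ≠ e' := fun h => he (h ▸ he')
      simp only [Set.mem_ofPred_eq, Function.update_comm hne]
    rw [Finset.sum_congr rfl fun e' he' => congrArg₂ (· - ·) (hterm e' he' true)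
      (hterm e' he' false)]
    simp only [id, Finset.sum_sub_distrib, Finset.sum_add_distrib, ← Finset.mul_sum, Pi.sub_apply]
    ring

/-- For an increasing event every term of Russo's formula is nonnegative, so no coupling of the
parameters is needed. -/
theorem prob_mono_of_determinedBy {A : Set (Config d)} {F : Set (Edge d)} (hF : F.Finite)
    (h : DeterminedBy A F) (hA : IsUpperSet A) : MonotoneOn (prob A) (Set.Icc 0 1) := by
  classical
  lift F to Finset (Edge d) using hF
  refine monotoneOn_of_hasDerivWithinAt_nonneg (convex_Icc 0 1)
    (fun t ht => (hasDerivWithinAt_prob h ht).continuousWithinAt)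
    (fun t ht => (hasDerivWithinAt_prob h (interior_subset ht)).mono interior_subset) ?_
  intro t _
  refine Finset.sum_nonneg fun e _ => sub_nonneg.2 (measureReal_mono fun ω hω => ?_)
  exact hA (update_le_update_iff.2 ⟨by simp, fun _ _ => le_rfl⟩) hω

/-! ### Edges, open paths inside a set, and explored clusters -/

namespace Edge

/-- The base vertex of an edge. -/
def src (e : Edge d) : Fin d → ℤ := e.1.base

/-- The vertex of an edge other than its base. -/
def tgt (e : Edge d) : Fin d → ℤ := fun i => e.1.base i + if i ∈ e.1.dirs then 1 else 0

/-- The unordered pair of vertices of an edge. -/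
def ends (e : Edge d) : Sym2 (Fin d → ℤ) := s(src e, tgt e)

theorem exists_dirs_eq (e : Edge d) : ∃ k, e.1.dirs = {k} := Finset.card_eq_one.1 e.2

theorem src_ne_tgt (e : Edge d) : src e ≠ tgt e := by
  obtain ⟨k, hk⟩ := exists_dirs_eq e
  intro h
  have := congrFun h k
  simp [src, tgt, hk] at this

theorem points_eq (e : Edge d) : e.1.points = {src e, tgt e} := by
  obtain ⟨k, hk⟩ := exists_dirs_eq e
  ext z
  simp only [Facet.points, hk, Set.mem_ofPred_eq, Finset.mem_singleton, Set.mem_insert_iff,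
    Set.mem_singleton_iff, src, tgt, funext_iff]
  constructor
  · intro h
    rcases h k with hz | ⟨-, hz⟩
    · refine .inl fun i => ?_
      rcases h i with h | ⟨rfl, -⟩
      exacts [h, hz]
    · refine .inr fun i => ?_
      by_cases hi : i = k
      · subst hi; simpa using hz
      · simpa [hi] using h i
  · rintro (h | h) i
    · exact .inl (h i)
    · by_cases hi : i = k
      · exact .inr ⟨hi, by simpa [hi] using h i⟩
      · exact .inl (by simpa [hi] using h i)

end Edge

theorem openGraph_adj {ω : Config d} {x y : Fin d → ℤ} :
    (openGraph ω).Adj x y ↔ ∃ e : Edge d, ω e = true ∧ Edge.ends e = s(x, y) := by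
  have key (e : Edge d) : e.1.points = {x, y} ↔ Edge.ends e = s(x, y) := by
    rw [Edge.points_eq, Edge.ends, Set.pair_eq_pair_iff, Sym2.eq_iff]
  constructor
  · rintro ⟨-, e, he, hp⟩
    exact ⟨e, he, (key e).1 hp⟩
  · rintro ⟨e, he, hp⟩
    refine ⟨fun hxy => ?_, e, he, (key e).2 hp⟩
    rw [hxy, Edge.ends, Sym2.eq_iff] at hp
    refine Edge.src_ne_tgt e ?_
    rcases hp with ⟨h1, h2⟩ | ⟨h1, h2⟩ <;> rw [h1, h2]

/-- The edges with both ends in `S`. -/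
def edgesInside (S : Set (Fin d → ℤ)) : Set (Edge d) := {e | ∀ x ∈ Edge.ends e, x ∈ S}

/-- The edges with an end in `S`. -/
def edgesTouching (S : Set (Fin d → ℤ)) : Set (Edge d) := {e | ∃ x ∈ Edge.ends e, x ∈ S}

theorem edgesInside_subset_edgesTouching (S : Set (Fin d → ℤ)) :
    edgesInside S ⊆ edgesTouching S :=
  fun e he => ⟨Edge.src e, by simp [Edge.ends], he _ (by simp [Edge.ends])⟩

theorem finite_edgesTouching {S : Set (Fin d → ℤ)} (hS : S.Finite) : (edgesTouching S).Finite := by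
  have hfin : ((fun q : (Fin d → ℤ) × Finset (Fin d) => Facet.mk q.1 q.2) '' (S ×ˢ Set.univ) ∪
      (fun q : (Fin d → ℤ) × Finset (Fin d) =>
        Facet.mk (fun i => q.1 i - if i ∈ q.2 then 1 else 0) q.2) '' (S ×ˢ Set.univ)).Finite :=
    ((hS.prod Set.finite_univ).image _).union ((hS.prod Set.finite_univ).image _)
  refine Set.Finite.of_finite_image (f := Subtype.val) (hfin.subset ?_)
    Subtype.val_injective.injOn
  rintro _ ⟨e, ⟨x, hx, hxS⟩, rfl⟩
  rw [Edge.ends, Sym2.mem_iff] at hx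
  rcases hx with rfl | rfl
  · exact .inl ⟨(_, e.1.dirs), ⟨hxS, trivial⟩, rfl⟩
  · exact .inr ⟨(_, e.1.dirs), ⟨hxS, trivial⟩, by simp⟩

theorem mem_of_reachable {V : Type*} {G : SimpleGraph V} {C : Set V}
    (hC : ∀ v w, v ∈ C → G.Adj v w → w ∈ C) {x y : V} (hx : x ∈ C) (h : G.Reachable x y) :
    y ∈ C := by
  rw [SimpleGraph.reachable_iff_reflTransGen] at h
  induction h with
  | refl => exact hx
  | tail _ hadj ih => exact hC _ _ ih hadj

/-- The graph of open edges with both ends in `S`. -/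
def openGraphIn (ω : Config d) (S : Set (Fin d → ℤ)) : SimpleGraph (Fin d → ℤ) where
  Adj x y := (openGraph ω).Adj x y ∧ x ∈ S ∧ y ∈ S
  symm := ⟨fun _ _ h => ⟨h.1.symm, h.2.2, h.2.1⟩⟩
  loopless := ⟨fun _ h => h.1.ne rfl⟩

theorem openGraphIn_le (ω : Config d) (S : Set (Fin d → ℤ)) : openGraphIn ω S ≤ openGraph ω :=
  fun _ _ h => h.1

theorem openGraphIn_mono (ω : Config d) {S T : Set (Fin d → ℤ)} (h : S ⊆ T) :
    openGraphIn ω S ≤ openGraphIn ω T :=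
  fun _ _ hxy => ⟨hxy.1, h hxy.2.1, h hxy.2.2⟩

/-- The event that `x` and `y` are joined by an open path in `S`. -/
def connIn (S : Set (Fin d → ℤ)) (x y : Fin d → ℤ) : Set (Config d) :=
  {ω | (openGraphIn ω S).Reachable x y}

theorem determinedBy_connIn (S : Set (Fin d → ℤ)) (x y : Fin d → ℤ) :
    DeterminedBy (connIn S x y) (edgesInside S) := by
  intro ω ω' hω h
  refine SimpleGraph.Reachable.mono ?_ h
  rintro v w ⟨hvw, hv, hw⟩
  obtain ⟨e, he, hends⟩ := openGraph_adj.1 hvw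
  refine ⟨openGraph_adj.2 ⟨e, ?_, hends⟩, hv, hw⟩
  rw [← hω e, he]
  intro x hx
  rw [hends, Sym2.mem_iff] at hx
  rcases hx with rfl | rfl <;> assumption

theorem openGraph_mono {ω ω' : Config d} (h : ω ≤ ω') : openGraph ω ≤ openGraph ω' := by
  intro x y hxy
  obtain ⟨e, he, hends⟩ := openGraph_adj.1 hxy
  refine openGraph_adj.2 ⟨e, ?_, hends⟩
  have := h e
  rw [he] at this
  exact top_le_iff.1 this

theorem isUpperSet_connIn (S : Set (Fin d → ℤ)) (x y : Fin d → ℤ) :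
    IsUpperSet (connIn S x y) :=
  fun ω ω' hω h => SimpleGraph.Reachable.mono (G := openGraphIn ω S) (G' := openGraphIn ω' S)
    (fun _ _ hvw => ⟨openGraph_mono hω hvw.1, hvw.2⟩) h

/-- The set of vertices joined to `u` by an open path in `S`. -/
def clusterIn (ω : Config d) (S : Set (Fin d → ℤ)) (u : Fin d → ℤ) : Set (Fin d → ℤ) :=
  {v | (openGraphIn ω S).Reachable u v}

theorem clusterIn_subset {ω : Config d} {S : Set (Fin d → ℤ)} {u : Fin d → ℤ} (hu : u ∈ S) :
    clusterIn ω S u ⊆ S :=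
  fun _ hv => mem_of_reachable (G := openGraphIn ω S) (fun _ _ _ h => h.2.2) hu hv

/-- Exploring the cluster of `u` in `S` inspects only edges inside `S` that touch the cluster found.
Connections avoiding `C` are therefore independent of this event. -/
theorem determinedBy_clusterIn_eq {S : Set (Fin d → ℤ)} {u : Fin d → ℤ} (hu : u ∈ S)
    (C : Set (Fin d → ℤ)) :
    DeterminedBy {ω | clusterIn ω S u = C} (edgesInside S ∩ edgesTouching C) := by
  intro ω ω' hω hC
  have hC : clusterIn ω S u = C := hC
  have hCS : C ⊆ S := hC ▸ clusterIn_subset hu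
  have huC : u ∈ C := hC ▸ SimpleGraph.Reachable.refl u
  have hadj {v w : Fin d → ℤ} (hv : v ∈ C) (hw : w ∈ S) :
      (openGraph ω).Adj v w ↔ (openGraph ω').Adj v w := by
    simp only [openGraph_adj]
    refine exists_congr fun e => and_congr_left fun hends => ?_
    rw [hω e]
    refine ⟨fun x hx => ?_, v, by simp [hends], hv⟩
    rw [hends, Sym2.mem_iff] at hx
    rcases hx with rfl | rfl
    exacts [hCS hv, hw]
  have hclosed {v w : Fin d → ℤ} (hv : v ∈ C) (hvw : (openGraphIn ω S).Adj v w) : w ∈ C := by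
    rw [← hC] at hv ⊢
    exact hv.trans hvw.reachable
  refine Set.Subset.antisymm (fun v hv => ?_) (fun v hv => ?_)
  · exact mem_of_reachable (G := openGraphIn ω' S) (fun v w hv hvw => hclosed hv
      ⟨(hadj hv hvw.2.2).2 hvw.1, hvw.2⟩) huC hv
  · have h : v ∈ {v | v ∈ C ∧ (openGraphIn ω' S).Reachable u v} := by
      refine mem_of_reachable (G := openGraphIn ω S) ?_ ⟨huC, .refl u⟩
        (by rw [← hC] at hv; exact hv)
      rintro v w ⟨hv, hr⟩ hvw
      refine ⟨hclosed hv hvw, hr.trans ?_⟩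
      exact SimpleGraph.Adj.reachable ⟨(hadj hv hvw.2.2).1 hvw.1, hvw.2⟩
    exact h.2

/-- The set of vertices whose open cluster is contained in `L`. -/
def confined (ω : Config d) (L : Set (Fin d → ℤ)) : Set (Fin d → ℤ) :=
  {x | openCluster ω x ⊆ L}

theorem confined_subset (ω : Config d) (L : Set (Fin d → ℤ)) : confined ω L ⊆ L :=
  fun x hx => hx (SimpleGraph.Reachable.refl x)

theorem mem_confined_of_adj {ω : Config d} {L : Set (Fin d → ℤ)} {x y : Fin d → ℤ}
    (h : (openGraph ω).Adj x y) (hx : x ∈ confined ω L) : y ∈ confined ω L :=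
  fun _ hz => hx (h.reachable.trans hz)

theorem determinedBy_mem_confined (L : Set (Fin d → ℤ)) (x : Fin d → ℤ) :
    DeterminedBy {ω | x ∈ confined ω L} (edgesTouching L) := by
  intro ω ω' hω hx y hy
  refine confined_subset ω L (mem_of_reachable (fun v w hv hvw => ?_) hx hy)
  obtain ⟨e, he, hends⟩ := openGraph_adj.1 hvw
  refine mem_confined_of_adj (openGraph_adj.2 ⟨e, ?_, hends⟩) hv
  rw [hω e ⟨v, by simp [hends], confined_subset ω L hv⟩, he]

/-- Explore from outside `L` inwards: a path from a non-confined vertex stays among non-confined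
vertices, so an edge with both ends in `S` is never inspected. This makes the event independent of
connections inside `S`. -/
theorem determinedBy_confined_eq (L S : Set (Fin d → ℤ)) :
    DeterminedBy {ω | confined ω L = S} (edgesTouching L ∩ (edgesInside S)ᶜ) := by
  refine DeterminedBy.inter_right (fun ω ω' hω hS => ?_) (fun ω ω' hω hS => ?_)
  · rw [Set.mem_ofPred_eq] at hS ⊢
    rw [← hS]
    ext x
    exact ((determinedBy_mem_confined L x).mem_iff hω).symm
  · have hS : confined ω L = S := hS
    have hadj {v w : Fin d → ℤ} (h : v ∉ S ∨ w ∉ S) :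
        (openGraph ω).Adj v w ↔ (openGraph ω').Adj v w := by
      simp only [openGraph_adj]
      refine exists_congr fun e => and_congr_left fun hends => ?_
      rw [hω e]
      intro hin
      rcases h with h | h
      · exact h (hin v (by simp [hends]))
      · exact h (hin w (by simp [hends]))
    refine Set.Subset.antisymm (fun x hx => ?_) (fun x hx y hy => ?_)
    · by_contra hxS
      refine hxS (hS ▸ fun y hy => ?_)
      have h : y ∈ {y | y ∉ S ∧ (openGraph ω').Reachable x y} := by
        refine mem_of_reachable (G := openGraph ω) ?_ ⟨hxS, .refl x⟩ hy
        rintro v w ⟨hv, hr⟩ hvw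
        refine ⟨fun hw => hv ?_, hr.trans ((hadj (.inl hv)).1 hvw).reachable⟩
        rw [← hS] at hw ⊢
        exact mem_confined_of_adj hvw.symm hw
      exact hx h.2
    · have hSL : S ⊆ L := hS ▸ confined_subset ω L
      refine hSL (mem_of_reachable (fun v w hv hvw => ?_) hx hy)
      by_contra hw
      refine hw ?_
      rw [← hS] at hv ⊢
      exact mem_confined_of_adj ((hadj (.inr hw)).2 hvw) hv

/-! ### Edge boundaries and the functional `phi` -/

open Classical in
/-- The edges with exactly one end in `S`. -/
noncomputable def edgeBoundary (S : Finset (Fin d → ℤ)) : Finset (Edge d) :=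
  (finite_edgesTouching S.finite_toSet).toFinset.filter fun e => e ∉ edgesInside (S : Set _)

open Classical in
/-- The end in `S` of an edge of the boundary of `S`. -/
noncomputable def innerEnd (S : Finset (Fin d → ℤ)) (e : Edge d) : Fin d → ℤ :=
  if Edge.src e ∈ S then Edge.src e else Edge.tgt e

open Classical in
/-- The end outside `S` of an edge of the boundary of `S`. -/
noncomputable def outerEnd (S : Finset (Fin d → ℤ)) (e : Edge d) : Fin d → ℤ :=
  if Edge.src e ∈ S then Edge.tgt e else Edge.src e

theorem ends_eq_inner_outer (S : Finset (Fin d → ℤ)) (e : Edge d) :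
    Edge.ends e = s(innerEnd S e, outerEnd S e) := by
  unfold innerEnd outerEnd Edge.ends
  split_ifs
  exacts [rfl, Sym2.eq_swap]

theorem mem_edgeBoundary {S : Finset (Fin d → ℤ)} {e : Edge d} :
    e ∈ edgeBoundary S ↔ innerEnd S e ∈ S ∧ outerEnd S e ∉ S := by
  simp only [edgeBoundary, edgesTouching, edgesInside, Set.mem_ofPred_eq, Edge.ends,
    innerEnd, outerEnd, Sym2.mem_iff]
  by_cases h : Edge.src e ∈ S <;> simp [h]

theorem inner_outer_of_ends {S : Finset (Fin d → ℤ)} {e : Edge d} {x y : Fin d → ℤ}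
    (h : Edge.ends e = s(x, y)) (hx : x ∈ S) (hy : y ∉ S) :
    innerEnd S e = x ∧ outerEnd S e = y := by
  rw [Edge.ends, Sym2.eq_iff] at h
  unfold innerEnd outerEnd
  rcases h with ⟨rfl, rfl⟩ | ⟨rfl, rfl⟩ <;> simp [hx, hy]

/-- The quantity `t ∑ P(u ↔ x in S)`, summed over the edges `⟨x, y⟩` of the boundary of `S`. -/
noncomputable def phi (S : Finset (Fin d → ℤ)) (u : Fin d → ℤ) (t : ℝ) : ℝ :=
  t * ∑ e ∈ edgeBoundary S, prob (connIn (S : Set _) u (innerEnd S e)) t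

theorem finite_edgesInside {S : Set (Fin d → ℤ)} (hS : S.Finite) : (edgesInside S).Finite :=
  (finite_edgesTouching hS).subset (edgesInside_subset_edgesTouching S)

theorem prob_nonneg (A : Set (Config d)) (t : ℝ) : 0 ≤ prob A t := measureReal_nonneg

theorem prob_le_one (A : Set (Config d)) (t : ℝ) : prob A t ≤ 1 := measureReal_le_one

theorem prob_mono {A B : Set (Config d)} (h : A ⊆ B) (t : ℝ) : prob A t ≤ prob B t :=
  measureReal_mono h

theorem phi_mono (S : Finset (Fin d → ℤ)) (u : Fin d → ℤ) {s t : ℝ} (hs : 0 ≤ s) (hst : s ≤ t)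
    (ht : t ≤ 1) : phi S u s ≤ phi S u t := by
  refine mul_le_mul hst (Finset.sum_le_sum fun e _ => ?_)
    (Finset.sum_nonneg fun e _ => prob_nonneg _ _) (hs.trans hst)
  exact prob_mono_of_determinedBy (finite_edgesInside S.finite_toSet) (determinedBy_connIn _ _ _)
    (isUpperSet_connIn _ _ _) ⟨hs, hst.trans ht⟩ ⟨hs.trans hst, ht⟩ hst

theorem prob_inter {A B : Set (Config d)} {F G : Set (Edge d)} (hA : DeterminedBy A F)
    (hB : DeterminedBy B G) (hF : F.Finite) (hG : G.Finite) (hFG : Disjoint F G) (t : ℝ) :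
    prob (A ∩ B) t = prob A t * prob B t := by
  rw [prob, Measure.real, hA.measure_inter _ hB hF hG hFG, ENNReal.toReal_mul]
  rfl

theorem prob_open (e : Edge d) {t : ℝ} (ht : t ∈ Set.Icc (0 : ℝ) 1) :
    prob {ω | ω e = true} t = t := by
  rw [prob, Measure.real, bondMeasure_open, Set.projIcc_of_mem _ ht,
    ENNReal.toReal_ofReal ht.1]

/-! ### The Simon–Lieb inequality and expected cluster sizes -/

/-- An open path leaving `S` makes a last exit from the cluster of its starting point in `S`. -/
theorem exists_last_exit {ω : Config d} {S : Finset (Fin d → ℤ)} {L : Set (Fin d → ℤ)}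
    {u z : Fin d → ℤ} (hu : u ∈ S) (hz : z ∉ S) (h : ω ∈ connIn L u z) :
    ∃ e ∈ edgeBoundary S, innerEnd S e ∈ clusterIn ω S u ∧ ω e = true ∧
      ω ∈ connIn (L \ clusterIn ω S u) (outerEnd S e) z := by
  set C := clusterIn ω (S : Set (Fin d → ℤ)) u with hC
  have hCS : C ⊆ S := clusterIn_subset hu
  have hr : Relation.ReflTransGen (openGraphIn ω L).Adj u z :=
    (SimpleGraph.reachable_iff_reflTransGen _ _).1 h
  -- Reading the path backwards from `z`, either the cluster `C` has not yet been met, or its last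
  -- exit edge is already found.
  have key : ∀ v, Relation.ReflTransGen (openGraphIn ω L).Adj v z →
      (v ∉ C ∧ ω ∈ connIn (L \ C) v z) ∨
      ∃ x ∈ C, ∃ y, y ∉ C ∧ (openGraph ω).Adj x y ∧ ω ∈ connIn (L \ C) y z := by
    intro v hv
    induction hv using Relation.ReflTransGen.head_induction_on with
    | refl => exact .inl ⟨fun h => hz (hCS h), SimpleGraph.Reachable.refl z⟩
    | @head a c hac _ ih =>
      rcases ih with ⟨hcC, hcon⟩ | h
      · by_cases haC : a ∈ C
        · exact .inr ⟨a, haC, c, hcC, hac.1, hcon⟩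
        · refine .inl ⟨haC, ?_⟩
          have hadj : (openGraphIn ω (L \ C)).Adj a c :=
            ⟨hac.1, ⟨hac.2.1, haC⟩, ⟨hac.2.2, hcC⟩⟩
          exact hadj.reachable.trans hcon
      · exact .inr h
  rcases key u hr with ⟨huC, -⟩ | ⟨x, hx, y, hy, hxy, hcon⟩
  · exact absurd (SimpleGraph.Reachable.refl u) huC
  -- An open edge from `C` to a vertex of `S` would put that vertex in `C`, so the exit edge leaves
  -- `S` itself.
  · have hyS : y ∉ S := fun hyS => hy <| by
      have hadj : (openGraphIn ω S).Adj x y := ⟨hxy, hCS hx, hyS⟩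
      exact SimpleGraph.Reachable.trans hx hadj.reachable
    obtain ⟨e, he, hends⟩ := openGraph_adj.1 hxy
    obtain ⟨hin, hout⟩ := inner_outer_of_ends hends (hCS hx) hyS
    exact ⟨e, mem_edgeBoundary.2 ⟨hin ▸ hCS hx, hout ▸ hyS⟩, hin ▸ hx, he, hout ▸ hcon⟩

theorem prob_biUnion_le {ι : Type*} (s : Finset ι) (A : ι → Set (Config d)) (t : ℝ) :
    prob (⋃ i ∈ s, A i) t ≤ ∑ i ∈ s, prob (A i) t :=
  measureReal_biUnion_finset_le s A

theorem connIn_mono {L L' : Set (Fin d → ℤ)} (h : L ⊆ L') (x y : Fin d → ℤ) :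
    connIn L x y ⊆ connIn L' x y :=
  fun ω hω => SimpleGraph.Reachable.mono (openGraphIn_mono ω h) hω

open Classical in
/-- The Simon–Lieb inequality. -/
theorem prob_connIn_le {S L : Finset (Fin d → ℤ)} {u z : Fin d → ℤ} (hu : u ∈ S) (hz : z ∉ S)
    {t : ℝ} (ht : t ∈ Set.Icc (0 : ℝ) 1) :
    prob (connIn (L : Set _) u z) t ≤ t * ∑ e ∈ edgeBoundary S,
      prob (connIn (S : Set _) u (innerEnd S e)) t *
        prob (connIn (L : Set _) (outerEnd S e) z) t := by
  let D (C : Finset (Fin d → ℤ)) : Set (Config d) := {ω | clusterIn ω (S : Set _) u = C}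
  let I (e : Edge d) : Finset (Finset (Fin d → ℤ)) :=
    S.powerset.filter fun C => innerEnd S e ∈ C
  let R (e : Edge d) (C : Finset (Fin d → ℤ)) : Set (Config d) :=
    connIn ((L : Set (Fin d → ℤ)) \ C) (outerEnd S e) z
  have hsub : connIn (L : Set _) u z ⊆
      ⋃ e ∈ edgeBoundary S, ⋃ C ∈ I e, (D C ∩ {ω | ω e = true}) ∩ R e C := by
    intro ω hω
    obtain ⟨e, he, hin, hopen, hcon⟩ := exists_last_exit hu hz hω
    obtain ⟨C, hC⟩ := (S.finite_toSet.subset (clusterIn_subset (ω := ω) hu)).exists_finset_coe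
    simp only [Set.mem_iUnion]
    refine ⟨e, he, C, ?_, ⟨hC.symm, hopen⟩, ?_⟩
    · rw [← hC] at hin
      refine Finset.mem_filter.2 ⟨Finset.mem_powerset.2 ?_, Finset.mem_coe.1 hin⟩
      exact_mod_cast hC ▸ clusterIn_subset (ω := ω) (S := (S : Set (Fin d → ℤ))) hu
    · simpa only [R, hC] using hcon
  have hD (C : Finset (Fin d → ℤ)) := determinedBy_clusterIn_eq (d := d)
    (S := (S : Set (Fin d → ℤ))) hu (C : Set (Fin d → ℤ))
  have hfinD (C : Finset (Fin d → ℤ)) : (edgesInside (S : Set (Fin d → ℤ)) ∩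
      edgesTouching (C : Set (Fin d → ℤ))).Finite :=
    (finite_edgesInside S.finite_toSet).subset Set.inter_subset_left
  -- For fixed `C` three disjoint edge sets are involved: edges inside `S` touching `C`, the edge
  -- `e` leaving `S` from `C`, and edges avoiding `C`. Hence the probability factorises.
  have hterm : ∀ e ∈ edgeBoundary S, ∀ C ∈ I e,
      prob ((D C ∩ {ω | ω e = true}) ∩ R e C) t ≤
        prob (D C) t * (t * prob (connIn (L : Set _) (outerEnd S e) z) t) := by
    intro e he C hC
    obtain ⟨hCS, hinC⟩ := Finset.mem_filter.1 hC
    obtain ⟨-, hout⟩ := mem_edgeBoundary.1 he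
    have hdisj : Disjoint (edgesInside (S : Set (Fin d → ℤ)) ∩ edgesTouching (C : Set _)) {e} := by
      rw [Set.disjoint_singleton_right]
      exact fun h => hout (h.1 _ (by simp [ends_eq_inner_outer S e]))
    have hDe : DeterminedBy (D C ∩ {ω | ω e = true})
        ((edgesInside (S : Set (Fin d → ℤ)) ∩ edgesTouching (C : Set _)) ∪ {e}) :=
      ((hD C).mono Set.subset_union_left).inter
        ((determinedBy_open e true).mono Set.subset_union_right)
    rw [prob_inter hDe (determinedBy_connIn _ _ _) ((hfinD C).union (Set.finite_singleton e))
      (finite_edgesInside (L.finite_toSet.subset Set.sdiff_subset)) ?_,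
      prob_inter (hD C) (determinedBy_open e true) (hfinD C) (Set.finite_singleton e) hdisj,
      prob_open e ht, mul_assoc]
    · exact mul_le_mul_of_nonneg_left (mul_le_mul_of_nonneg_left
        (prob_mono (connIn_mono Set.sdiff_subset _ _) t) ht.1) (prob_nonneg _ _)
    · rw [Set.disjoint_left]
      rintro e' (⟨-, x, hx, hxC⟩ | rfl) h
      · exact (h x hx).2 hxC
      · exact (h _ (by rw [ends_eq_inner_outer S e']; exact Sym2.mem_mk_left _ _)).2 hinC
  -- The events `D C` are disjoint, and each one with `innerEnd S e ∈ C` implies a connection from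
  -- `u` to `innerEnd S e` in `S`.
  have hsum (e : Edge d) : ∑ C ∈ I e, prob (D C) t ≤
      prob (connIn (S : Set _) u (innerEnd S e)) t := by
    rw [show ∑ C ∈ I e, prob (D C) t = prob (⋃ C ∈ I e, D C) t from
      (measureReal_biUnion_finset (fun C _ C' _ hne => ?_)
        fun C _ => (hD C).measurableSet (hfinD C)).symm]
    · refine prob_mono (Set.iUnion₂_subset fun C hC ω hω => ?_) t
      have hin : innerEnd S e ∈ (C : Set _) := (Finset.mem_filter.1 hC).2
      have hω : clusterIn ω (S : Set _) u = C := hω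
      rw [← hω] at hin
      exact hin
    · refine Set.disjoint_left.2 fun ω h h' => hne (Finset.coe_injective ?_)
      exact Eq.trans (Eq.symm h) h'
  calc prob (connIn (L : Set _) u z) t
      ≤ ∑ e ∈ edgeBoundary S, ∑ C ∈ I e, prob ((D C ∩ {ω | ω e = true}) ∩ R e C) t :=
        (prob_mono hsub t).trans ((prob_biUnion_le _ _ t).trans
          (Finset.sum_le_sum fun e _ => prob_biUnion_le _ _ t))
    _ ≤ ∑ e ∈ edgeBoundary S, (∑ C ∈ I e, prob (D C) t) *
          (t * prob (connIn (L : Set _) (outerEnd S e) z) t) := by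
        refine Finset.sum_le_sum fun e he => ?_
        rw [Finset.sum_mul]
        exact Finset.sum_le_sum (hterm e he)
    _ ≤ ∑ e ∈ edgeBoundary S, prob (connIn (S : Set _) u (innerEnd S e)) t *
          (t * prob (connIn (L : Set _) (outerEnd S e) z) t) :=
        Finset.sum_le_sum fun e _ => mul_le_mul_of_nonneg_right (hsum e)
          (mul_nonneg ht.1 (prob_nonneg _ _))
    _ = _ := by
        rw [Finset.mul_sum]
        exact Finset.sum_congr rfl fun e _ => by ring

/-- If every vertex `u` has a neighbourhood `S u` of bounded size with `phi (S u) u t ≤ c < 1`, then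
the expected sizes of open clusters are bounded. -/
theorem sum_prob_connIn_le {S : (Fin d → ℤ) → Finset (Fin d → ℤ)} (hS : ∀ u, u ∈ S u) {n : ℕ}
    (hn : ∀ u, (S u).card ≤ n) {c t : ℝ} (ht : t ∈ Set.Icc (0 : ℝ) 1) (hc : c < 1)
    (hphi : ∀ u, phi (S u) u t ≤ c) (L : Finset (Fin d → ℤ)) (u : Fin d → ℤ) :
    ∑ z ∈ L, prob (connIn (L : Set _) u z) t ≤ n / (1 - c) := by
  classical
  let f (u : Fin d → ℤ) : ℝ := ∑ z ∈ L, prob (connIn (L : Set _) u z) t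
  -- This a priori bound is why `L` is finite: the supremum `M` must be finite before `M ≤ n + c *
  -- M` can be solved for `M`.
  have hbdd : BddAbove (Set.range f) := by
    refine ⟨L.card, ?_⟩
    rintro _ ⟨u, rfl⟩
    exact (Finset.sum_le_card_nsmul _ _ 1 fun z _ => prob_le_one _ _).trans (by simp)
  have hM0 : 0 ≤ ⨆ u, f u :=
    (Finset.sum_nonneg fun z _ => prob_nonneg _ _).trans (le_ciSup hbdd (0 : Fin d → ℤ))
  have hstep (u : Fin d → ℤ) : f u ≤ n + c * ⨆ u, f u := by
    have hsplit := Finset.sum_filter_add_sum_filter_not L (fun z => z ∈ S u)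
      (fun z => prob (connIn (L : Set _) u z) t)
    have h1 : ∑ z ∈ L.filter (fun z => z ∈ S u), prob (connIn (L : Set _) u z) t ≤ n := by
      refine (Finset.sum_le_card_nsmul _ _ 1 fun z _ => prob_le_one _ _).trans ?_
      rw [nsmul_eq_mul, mul_one]
      exact_mod_cast (Finset.card_le_card fun z hz => (Finset.mem_filter.1 hz).2).trans (hn u)
    -- By Simon–Lieb, targets outside `S u` cost a factor `phi (S u) u t ≤ c` times the sum
    -- restarted at an outer end.
    have h2 : ∑ z ∈ L.filter (fun z => z ∉ S u), prob (connIn (L : Set _) u z) t ≤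
        c * ⨆ u, f u := by
      calc _ ≤ ∑ z ∈ L.filter (fun z => z ∉ S u), t * ∑ e ∈ edgeBoundary (S u),
            prob (connIn (S u : Set _) u (innerEnd (S u) e)) t *
              prob (connIn (L : Set _) (outerEnd (S u) e) z) t :=
            Finset.sum_le_sum fun z hz => prob_connIn_le (hS u) (Finset.mem_filter.1 hz).2 ht
        _ ≤ ∑ z ∈ L, t * ∑ e ∈ edgeBoundary (S u),
            prob (connIn (S u : Set _) u (innerEnd (S u) e)) t *
              prob (connIn (L : Set _) (outerEnd (S u) e) z) t :=
            Finset.sum_le_sum_of_subset_of_nonneg (Finset.filter_subset _ _) fun z _ _ =>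
              mul_nonneg ht.1 (Finset.sum_nonneg fun e _ =>
                mul_nonneg (prob_nonneg _ _) (prob_nonneg _ _))
        _ = t * ∑ e ∈ edgeBoundary (S u),
            prob (connIn (S u : Set _) u (innerEnd (S u) e)) t * f (outerEnd (S u) e) := by
            rw [← Finset.mul_sum, Finset.sum_comm]
            simp only [f, Finset.mul_sum]
        _ ≤ t * ∑ e ∈ edgeBoundary (S u),
            prob (connIn (S u : Set _) u (innerEnd (S u) e)) t * ⨆ u, f u :=
            mul_le_mul_of_nonneg_left (Finset.sum_le_sum fun e _ =>
              mul_le_mul_of_nonneg_left (le_ciSup hbdd _) (prob_nonneg _ _)) ht.1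
        _ = phi (S u) u t * ⨆ u, f u := by rw [← Finset.sum_mul, phi, mul_assoc]
        _ ≤ _ := mul_le_mul_of_nonneg_right (hphi u) hM0
    exact hsplit.symm.le.trans (add_le_add h1 h2)
  have hM := ciSup_le hstep
  refine (le_ciSup hbdd u).trans ?_
  rw [le_div_iff₀ (by linarith)]
  linarith

/-! ### The differential inequality -/

/-- The Duminil-Copin–Tassion differential inequality, integrated. -/
theorem prob_mem_confined_le {L : Finset (Fin d → ℤ)} {u : Fin d → ℤ} {p q : ℝ} (hp : 0 ≤ p)
    (hpq : p ≤ q) (hq : q ≤ 1) (hphi : ∀ S : Finset (Fin d → ℤ), u ∈ S → 1 ≤ phi S u p) :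
    prob {ω | u ∈ confined ω (L : Set _)} q ≤ Real.exp (-(q - p)) := by
  classical
  set B : Set (Config d) := {ω | u ∈ confined ω (L : Set _)} with hB
  have hfin := finite_edgesTouching L.finite_toSet
  set F : Finset (Edge d) := hfin.toFinset with hF
  have hdet : DeterminedBy B (F : Set (Edge d)) := by
    rw [hF, Set.Finite.coe_toFinset]
    exact determinedBy_mem_confined _ u
  have hlower {ω ω' : Config d} (h : ω' ≤ ω) (hω : ω ∈ B) : ω' ∈ B :=
    fun y hy => hω (SimpleGraph.Reachable.mono (openGraph_mono h) hy)
  let Q (S : Finset (Fin d → ℤ)) : Set (Config d) := {ω | confined ω (L : Set _) = S}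
  let T : Finset (Finset (Fin d → ℤ)) := L.powerset.filter fun S => u ∈ S
  have hQ (S : Finset (Fin d → ℤ)) := determinedBy_confined_eq (d := d) (L : Set _) (S : Set _)
  have hQfin (S : Finset (Fin d → ℤ)) :
      (edgesTouching (L : Set (Fin d → ℤ)) ∩ (edgesInside (S : Set (Fin d → ℤ)))ᶜ).Finite :=
    hfin.subset Set.inter_subset_left
  have hQdisj {S S' : Finset (Fin d → ℤ)} {ω : Config d} (h : ω ∈ Q S) (h' : ω ∈ Q S') : S = S' :=
    Finset.coe_injective (Eq.trans (Eq.symm h) h')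
  have hBQ : B ⊆ ⋃ S ∈ T, Q S := by
    intro ω hω
    have hsub := confined_subset ω (L : Set (Fin d → ℤ))
    obtain ⟨S, hS⟩ := (L.finite_toSet.subset hsub).exists_finset_coe
    simp only [Set.mem_iUnion]
    refine ⟨S, Finset.mem_filter.2 ⟨Finset.mem_powerset.2 ?_, ?_⟩, hS.symm⟩
    · exact_mod_cast hS ▸ hsub
    · have : u ∈ confined ω (L : Set (Fin d → ℤ)) := hω
      rw [← hS] at this
      exact this
  let piv (e : Edge d) : Set (Config d) := {ω | ω ∈ B ∧ Function.update ω e true ∉ B}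
  -- When the confined set is `S` and `u` is joined within `S` to an inner end, opening the edge
  -- attaches `u` to a vertex whose cluster leaves `L`: the edge is pivotal.
  have hpiv : ∀ S ∈ T, ∀ e ∈ edgeBoundary S,
      Q S ∩ connIn (S : Set _) u (innerEnd S e) ⊆ piv e := by
    rintro S hS e he ω ⟨hωS, hcon⟩
    have hωS : confined ω (L : Set _) = S := hωS
    obtain ⟨-, huS⟩ := Finset.mem_filter.1 hS
    obtain ⟨-, hout⟩ := mem_edgeBoundary.1 he
    refine ⟨show u ∈ confined ω (L : Set _) from hωS ▸ huS, fun hupd => hout ?_⟩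
    have hle : ω ≤ Function.update ω e true := le_update_iff.2 ⟨le_top, fun _ _ => le_rfl⟩
    have hadj : (openGraph (Function.update ω e true)).Adj (innerEnd S e) (outerEnd S e) :=
      openGraph_adj.2 ⟨e, by simp, ends_eq_inner_outer S e⟩
    have hreach : (openGraph (Function.update ω e true)).Reachable u (outerEnd S e) :=
      (SimpleGraph.Reachable.mono ((openGraphIn_le ω _).trans (openGraph_mono hle)) hcon).trans
        hadj.reachable
    have hmem : outerEnd S e ∈ confined ω (L : Set _) := fun y hy =>
      hupd (hreach.trans (SimpleGraph.Reachable.mono (openGraph_mono hle) hy))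
    rw [hωS] at hmem
    exact hmem
  have hboundary : ∀ S ∈ T, edgeBoundary S ⊆ F := by
    intro S hS e he
    rw [hF, Set.Finite.mem_toFinset]
    obtain ⟨hin, -⟩ := mem_edgeBoundary.1 he
    exact ⟨innerEnd S e, by simp [ends_eq_inner_outer S e],
      Finset.mem_powerset.1 (Finset.mem_filter.1 hS).1 hin⟩
  have hmain : ∀ t ∈ Set.Icc p q, ∑ e ∈ F, (prob {ω | Function.update ω e true ∈ B} t -
      prob {ω | Function.update ω e false ∈ B} t) ≤ -prob B t := by
    intro t ht
    have ht01 : t ∈ Set.Icc (0 : ℝ) 1 := ⟨hp.trans ht.1, ht.2.trans hq⟩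
    have hterm (e : Edge d) : prob (piv e) t ≤ prob {ω | Function.update ω e false ∈ B} t -
        prob {ω | Function.update ω e true ∈ B} t := by
      have hsub : {ω | Function.update ω e true ∈ B} ⊆ {ω | Function.update ω e false ∈ B} :=
        fun ω hω => hlower (update_le_update_iff.2 ⟨by simp, fun _ _ => le_rfl⟩) hω
      have hms : MeasurableSet {ω | Function.update ω e true ∈ B} :=
        (hdet.update e true).measurableSet (F.finite_toSet.subset Set.sdiff_subset)
      have hpsub : piv e ⊆ {ω | Function.update ω e false ∈ B} \ {ω | Function.update ω e true ∈ B} :=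
        fun ω hω => ⟨hlower (update_le_iff.2 ⟨by simp, fun _ _ => le_rfl⟩) hω.1, hω.2⟩
      exact (measureReal_mono hpsub).trans (measureReal_sdiff hsub hms).le
    have hlow (e : Edge d) : ∑ S ∈ T, (if e ∈ edgeBoundary S then
        prob (Q S ∩ connIn (S : Set _) u (innerEnd S e)) t else 0) ≤ prob (piv e) t := by
      rw [← Finset.sum_filter]
      rw [show ∑ S ∈ T.filter (fun S => e ∈ edgeBoundary S),
          prob (Q S ∩ connIn (S : Set _) u (innerEnd S e)) t =
          prob (⋃ S ∈ T.filter (fun S => e ∈ edgeBoundary S),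
            Q S ∩ connIn (S : Set _) u (innerEnd S e)) t from
        (measureReal_biUnion_finset (fun S _ S' _ hne => ?_) fun S _ => ?_).symm]
      · refine prob_mono (Set.iUnion₂_subset fun S hS => ?_) t
        exact hpiv S (Finset.mem_filter.1 hS).1 e (Finset.mem_filter.1 hS).2
      · exact Set.disjoint_left.2 fun ω h h' => hne (hQdisj h.1 h'.1)
      · exact ((hQ S).measurableSet (hQfin S)).inter
          ((determinedBy_connIn _ _ _).measurableSet (finite_edgesInside S.finite_toSet))
    have hS : ∀ S ∈ T, prob (Q S) t ≤ ∑ e ∈ F, (if e ∈ edgeBoundary S then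
        prob (Q S ∩ connIn (S : Set _) u (innerEnd S e)) t else 0) := by
      intro S hS
      rw [← Finset.sum_filter, Finset.filter_mem_eq_inter,
        Finset.inter_eq_right.2 (hboundary S hS)]
      have hind (e : Edge d) : prob (Q S ∩ connIn (S : Set _) u (innerEnd S e)) t =
          prob (Q S) t * prob (connIn (S : Set _) u (innerEnd S e)) t :=
        prob_inter (hQ S) (determinedBy_connIn _ _ _) (hQfin S)
          (finite_edgesInside S.finite_toSet)
          (Set.disjoint_left.2 fun e h h' => h.2 h') t
      simp only [hind, ← Finset.mul_sum]
      -- `phi S u t ≥ 1` and `t ≤ 1` give a sum of connection probabilities of at least 1.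
      refine le_mul_of_one_le_right (prob_nonneg _ _) ?_
      have h1 := (hphi S (Finset.mem_filter.1 hS).2).trans (phi_mono S u hp ht.1 ht01.2)
      exact h1.trans (mul_le_of_le_one_left (Finset.sum_nonneg fun e _ => prob_nonneg _ _) ht01.2)
    have hB : prob B t ≤ ∑ e ∈ F, prob (piv e) t :=
      calc prob B t ≤ ∑ S ∈ T, prob (Q S) t := (prob_mono hBQ t).trans (prob_biUnion_le _ _ t)
        _ ≤ _ := Finset.sum_le_sum hS
        _ ≤ _ := by
          rw [Finset.sum_comm]
          exact Finset.sum_le_sum fun e _ => hlow e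
    have := hB.trans (Finset.sum_le_sum fun e _ => hterm e)
    rw [Finset.sum_sub_distrib] at this ⊢
    linarith
  have hsub : Set.Icc p q ⊆ Set.Icc 0 1 := Set.Icc_subset_Icc hp hq
  have hderiv : ∀ t ∈ Set.Icc p q, HasDerivWithinAt (fun t => prob B t * Real.exp t)
      ((∑ e ∈ F, (prob {ω | Function.update ω e true ∈ B} t -
        prob {ω | Function.update ω e false ∈ B} t)) * Real.exp t + prob B t * Real.exp t)
      (Set.Icc p q) t := fun t ht =>
    ((hasDerivWithinAt_prob hdet (hsub ht)).mono hsub).mul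
      (Real.hasDerivAt_exp t).hasDerivWithinAt
  -- The derivative of `prob B` is at most `-prob B`; use the integrating factor `exp t`.
  have hanti : AntitoneOn (fun t => prob B t * Real.exp t) (Set.Icc p q) := by
    refine antitoneOn_of_hasDerivWithinAt_nonpos (convex_Icc p q)
      (fun t ht => (hderiv t ht).continuousWithinAt)
      (fun t ht => (hderiv t (interior_subset ht)).mono interior_subset) fun t ht => ?_
    rw [← add_mul]
    exact mul_nonpos_of_nonpos_of_nonneg (by linarith [hmain t (interior_subset ht)])
      (Real.exp_pos t).le
  have h := hanti (Set.left_mem_Icc.2 hpq) (Set.right_mem_Icc.2 hpq) hpq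
  have h1 : prob B q * Real.exp q ≤ Real.exp p :=
    h.trans (mul_le_of_le_one_left (Real.exp_pos p).le (prob_le_one _ _))
  rw [neg_sub, Real.exp_sub, le_div_iff₀ (Real.exp_pos q)]
  exact h1

/-! ### Translation invariance -/

/-- Translation of edges. -/
def shiftEdge (v : Fin d → ℤ) : Edge d ≃ Edge d where
  toFun e := ⟨⟨e.1.base + v, e.1.dirs⟩, e.2⟩
  invFun e := ⟨⟨e.1.base - v, e.1.dirs⟩, e.2⟩
  left_inv e := by simp
  right_inv e := by simp

theorem src_shiftEdge (v : Fin d → ℤ) (e : Edge d) :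
    Edge.src (shiftEdge v e) = Edge.src e + v := rfl

theorem tgt_shiftEdge (v : Fin d → ℤ) (e : Edge d) :
    Edge.tgt (shiftEdge v e) = Edge.tgt e + v := by
  ext i
  exact add_right_comm _ _ _

/-- Translation of configurations. -/
def shiftConfig (v : Fin d → ℤ) (ω : Config d) : Config d := fun e => ω (shiftEdge v e)

theorem measurePreserving_shiftConfig (v : Fin d → ℤ) (p : unitInterval) :
    MeasurePreserving (shiftConfig v) (bondMeasure d p) (bondMeasure d p) :=
  ⟨measurable_pi_lambda _ fun _ => measurable_pi_apply _,
    Measure.map_infinitePi_infinitePi_of_inj (shiftEdge v).injective⟩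

theorem openGraph_shiftConfig_adj (v : Fin d → ℤ) (ω : Config d) (x y : Fin d → ℤ) :
    (openGraph (shiftConfig v ω)).Adj x y ↔ (openGraph ω).Adj (x + v) (y + v) := by
  rw [openGraph_adj, openGraph_adj, (shiftEdge v).surjective.exists
    (p := fun e => ω e = true ∧ Edge.ends e = s(x + v, y + v))]
  refine exists_congr fun e => and_congr_right fun _ => ?_
  simp [Edge.ends, src_shiftEdge, tgt_shiftEdge]

theorem openGraphIn_shiftConfig_reachable (v : Fin d → ℤ) (ω : Config d)
    (S : Set (Fin d → ℤ)) (x y : Fin d → ℤ) :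
    (openGraphIn (shiftConfig v ω) S).Reachable x y ↔
      (openGraphIn ω ((· + v) '' S)).Reachable (x + v) (y + v) := by
  let φ : openGraphIn (shiftConfig v ω) S ≃g openGraphIn ω ((· + v) '' S) :=
    { toEquiv := Equiv.addRight v
      map_rel_iff' := by
        intro a b
        change (openGraph ω).Adj (a + v) (b + v) ∧ a + v ∈ _ ∧ b + v ∈ _ ↔
          (openGraph (shiftConfig v ω)).Adj a b ∧ _ ∧ _
        rw [openGraph_shiftConfig_adj, (add_left_injective v).mem_set_image,
          (add_left_injective v).mem_set_image] }
  exact φ.reachable_iff.symm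

theorem prob_connIn_shift (v : Fin d → ℤ) (S : Finset (Fin d → ℤ)) (x y : Fin d → ℤ) (t : ℝ) :
    prob (connIn (S.map (Equiv.addRight v).toEmbedding : Set _) (x + v) (y + v)) t =
      prob (connIn (S : Set _) x y) t := by
  have hpre : shiftConfig v ⁻¹' connIn (S : Set _) x y =
      connIn (S.map (Equiv.addRight v).toEmbedding : Set _) (x + v) (y + v) := by
    ext ω
    rw [Finset.coe_map]
    exact openGraphIn_shiftConfig_reachable v ω S x y
  rw [← hpre, prob, prob, Measure.real, Measure.real,
    (measurePreserving_shiftConfig v _).measure_preimage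
    ((determinedBy_connIn _ _ _).measurableSet
      (finite_edgesInside S.finite_toSet)).nullMeasurableSet]

theorem phi_shift (v : Fin d → ℤ) (S : Finset (Fin d → ℤ)) (u : Fin d → ℤ) (t : ℝ) :
    phi (S.map (Equiv.addRight v).toEmbedding) (u + v) t = phi S u t := by
  have hmem (x : Fin d → ℤ) : x + v ∈ S.map (Equiv.addRight v).toEmbedding ↔ x ∈ S := by
    simp
  have hin (e : Edge d) : innerEnd (S.map (Equiv.addRight v).toEmbedding) (shiftEdge v e) =
      innerEnd S e + v := by
    simp only [innerEnd, src_shiftEdge, tgt_shiftEdge, hmem, ite_add]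
  have hout (e : Edge d) : outerEnd (S.map (Equiv.addRight v).toEmbedding) (shiftEdge v e) =
      outerEnd S e + v := by
    simp only [outerEnd, src_shiftEdge, tgt_shiftEdge, hmem, ite_add]
  rw [phi, phi]
  congr 1
  refine (Finset.sum_equiv (shiftEdge v) (fun e => ?_) fun e _ => ?_).symm
  · rw [mem_edgeBoundary, mem_edgeBoundary, hin, hout, hmem, hmem]
  · rw [hin, prob_connIn_shift]

/-! ### Sharpness and disconnection of coordinate rays below `pc` -/

theorem pc_le_one (d : ℕ) : pc d ≤ 1 := by
  rcases Set.eq_empty_or_nonempty {p : ℝ | ∃ q : unitInterval, (q : ℝ) = p ∧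
    0 < bondMeasure d q {ω | HasInfiniteCluster ω}} with h | ⟨p, q, hq, hpos⟩
  -- The real infimum of the empty set is 0 by convention.
  · rw [pc, h, Real.sInf_empty]; exact zero_le_one
  · have hbdd : BddBelow {p : ℝ | ∃ q : unitInterval, (q : ℝ) = p ∧
        0 < bondMeasure d q {ω | HasInfiniteCluster ω}} :=
      ⟨0, by rintro _ ⟨q, rfl, -⟩; exact q.2.1⟩
    exact (csInf_le hbdd ⟨q, hq, hpos⟩).trans (hq ▸ q.2.2)

/-- The box `[-n, n]^d`. -/
noncomputable def box (d n : ℕ) : Finset (Fin d → ℤ) :=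
  Finset.Icc (fun _ => -(n : ℤ)) (fun _ => (n : ℤ))

theorem box_mono : Monotone (box d) := by
  intro m n h
  have : (m : ℤ) ≤ n := by exact_mod_cast h
  exact Finset.Icc_subset_Icc (fun _ => neg_le_neg this) (fun _ => this)

theorem exists_mem_box (x : Fin d → ℤ) : ∃ n, x ∈ box d n := by
  refine ⟨∑ i, (x i).natAbs, Finset.mem_Icc.2 ⟨fun i => ?_, fun i => ?_⟩⟩ <;>
  · have := Finset.single_le_sum (f := fun i => (x i).natAbs) (fun _ _ => Nat.zero_le _)
      (Finset.mem_univ i)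
    dsimp only at this ⊢
    omega

theorem exists_subset_box {C : Set (Fin d → ℤ)} (hC : C.Finite) : ∃ n, C ⊆ box d n := by
  choose f hf using exists_mem_box (d := d)
  obtain ⟨N, hN⟩ := (hC.image f).bddAbove
  exact ⟨N, fun x hx => box_mono (hN ⟨x, hx, rfl⟩) (hf x)⟩

/-- Sharpness of the phase transition. -/
theorem exists_phi_lt_one {p : unitInterval} (hp : (p : ℝ) < pc d) :
    ∃ S : Finset (Fin d → ℤ), 0 ∈ S ∧ phi S 0 p < 1 := by
  by_contra! hcon
  obtain ⟨q, hpq, hq⟩ := exists_between hp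
  have hq1 : q ≤ 1 := hq.le.trans (pc_le_one d)
  have hq01 : q ∈ Set.Icc (0 : ℝ) 1 := ⟨p.2.1.trans hpq.le, hq1⟩
  set μ := bondMeasure d ⟨q, hq01⟩ with hμ
  have hnull : μ {ω | HasInfiniteCluster ω} = 0 := by
    by_contra hne
    exact hq.not_ge (csInf_le ⟨0, by rintro _ ⟨q, rfl, -⟩; exact q.2.1⟩
      ⟨⟨q, hq01⟩, rfl, pos_iff_ne_zero.2 hne⟩)
  have hle (n : ℕ) : μ {ω | (0 : Fin d → ℤ) ∈ confined ω (box d n : Set _)} ≤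
      ENNReal.ofReal (Real.exp (-(q - p))) := by
    have := prob_mem_confined_le (L := box d n) p.2.1 hpq.le hq1 hcon
    rw [prob, Set.projIcc_of_mem _ hq01] at this
    exact (ENNReal.le_ofReal_iff_toReal_le (measure_ne_top _ _) (Real.exp_pos _).le).2 this
  have hmono : Monotone fun n : ℕ => {ω : Config d | 0 ∈ confined ω (box d n : Set _)} :=
    fun m n hmn ω hω y hy => box_mono hmn (hω hy)
  have hunion : μ (⋃ n : ℕ, {ω | (0 : Fin d → ℤ) ∈ confined ω (box d n : Set _)}) ≤
      ENNReal.ofReal (Real.exp (-(q - p))) := by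
    rw [hmono.measure_iUnion]
    exact iSup_le hle
  -- Without an infinite cluster, the cluster of 0 lies in some box. Subadditivity then gives `1 ≤
  -- exp (-(q - p))`, with no need for measurability of `HasInfiniteCluster`.
  have huniv : (Set.univ : Set (Config d)) ⊆ {ω | HasInfiniteCluster ω} ∪
      ⋃ n : ℕ, {ω | (0 : Fin d → ℤ) ∈ confined ω (box d n : Set _)} := by
    intro ω _
    by_cases h : (openCluster ω 0).Infinite
    · exact .inl ⟨0, h⟩
    · obtain ⟨n, hn⟩ := exists_subset_box (Set.not_infinite.1 h)
      exact .inr (Set.mem_iUnion.2 ⟨n, hn⟩)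
  have h1 := (measure_mono (μ := μ) huniv).trans (measure_union_le _ _)
  rw [hnull, zero_add, measure_univ] at h1
  have h2 := h1.trans hunion
  rw [ENNReal.one_le_ofReal, Real.one_le_exp_iff] at h2
  linarith

/-- The event that `x` and `y` are in the same open cluster. -/
def conn (x y : Fin d → ℤ) : Set (Config d) := {ω | (openGraph ω).Reachable x y}

theorem conn_eq_iUnion (x y : Fin d → ℤ) : conn x y = ⋃ n : ℕ, connIn (box d n : Set _) x y := by
  ext ω
  rw [Set.mem_iUnion]
  constructor
  · intro h
    refine mem_of_reachable (C := {y | ∃ n : ℕ, ω ∈ connIn (box d n : Set _) x y}) ?_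
      ⟨0, SimpleGraph.Reachable.refl x⟩ h
    rintro v w ⟨n, hn⟩ hvw
    obtain ⟨m, hm⟩ := exists_subset_box (Set.toFinite {v, w})
    refine ⟨max m n, ?_⟩
    have hadj : (openGraphIn ω (box d (max m n) : Set _)).Adj v w :=
      ⟨hvw, box_mono (le_max_left m n) (hm (by simp)), box_mono (le_max_left m n) (hm (by simp))⟩
    exact SimpleGraph.Reachable.trans
      (connIn_mono (by exact_mod_cast box_mono (le_max_right m n)) x v hn) hadj.reachable
  · rintro ⟨n, hn⟩
    exact SimpleGraph.Reachable.mono (openGraphIn_le ω _) hn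

theorem monotone_connIn_box (x y : Fin d → ℤ) :
    Monotone fun n : ℕ => connIn (box d n : Set _) x y :=
  fun _ _ h => connIn_mono (by exact_mod_cast box_mono h) x y

theorem measurableSet_conn (x y : Fin d → ℤ) : MeasurableSet (conn x y) := by
  rw [conn_eq_iUnion]
  exact .iUnion fun n => (determinedBy_connIn _ _ _).measurableSet
    (finite_edgesInside (box d n).finite_toSet)

theorem measure_conn_add (p : unitInterval) (v x y : Fin d → ℤ) :
    bondMeasure d p (conn (x + v) (y + v)) = bondMeasure d p (conn x y) := by
  rw [← (measurePreserving_shiftConfig v p).measure_preimage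
    (measurableSet_conn x y).nullMeasurableSet]
  congr 1
  ext ω
  let φ : openGraph (shiftConfig v ω) ≃g openGraph ω :=
    { toEquiv := Equiv.addRight v
      map_rel_iff' := (openGraph_shiftConfig_adj v ω _ _).symm }
  exact φ.reachable_iff (u := x) (v := y)

/-- Below the critical point, the expected size of the open cluster of a vertex is finite. -/
theorem tsum_measure_conn_ne_top {p : unitInterval} (hp : (p : ℝ) < pc d) (u : Fin d → ℤ) :
    ∑' z, bondMeasure d p (conn u z) ≠ ⊤ := by
  classical
  obtain ⟨S, hS0, hS⟩ := exists_phi_lt_one hp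
  have hbound := sum_prob_connIn_le (S := fun u => S.map (Equiv.addRight u).toEmbedding)
    (fun u => by simpa using hS0) (n := S.card) (fun u => by simp) p.2 hS
    (fun u => by simpa using (phi_shift u S 0 p).le)
  refine ne_top_of_le_ne_top (b := ENNReal.ofReal (S.card / (1 - phi S 0 p)))
    ENNReal.ofReal_ne_top ?_
  rw [ENNReal.tsum_eq_iSup_sum]
  refine iSup_le fun Z => ?_
  simp only [conn_eq_iUnion, (monotone_connIn_box _ _).measure_iUnion]
  rw [ENNReal.finsetSum_iSup_of_monotone fun z _ _ h => measure_mono (monotone_connIn_box u z h)]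
  refine iSup_le fun n => ?_
  -- Enlarging the domain to `box d n ∪ Z` makes the sum over `Z` part of the bounded sum.
  refine le_trans ?_ (ENNReal.ofReal_le_ofReal (hbound (box d n ∪ Z) u))
  rw [ENNReal.ofReal_sum_of_nonneg fun _ _ => prob_nonneg _ _]
  refine (Finset.sum_le_sum fun z _ => ?_).trans
    (Finset.sum_le_sum_of_subset Finset.subset_union_right)
  rw [prob, Set.projIcc_of_mem _ p.2, ofReal_measureReal]
  exact measure_mono (connIn_mono (by simp) u z)

/-- Below the critical point, the tails of two distinct coordinate rays are almost surely not
connected. -/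
theorem ae_exists_rays_not_connected {p : unitInterval} (hp : (p : ℝ) < pc d) {i j : Fin d}
    (hij : i ≠ j) : ∀ᵐ ω ∂bondMeasure d p, ∃ N : ℕ, ∀ m ≥ N, ∀ n ≥ N,
      ¬ (openGraph ω).Reachable (Pi.single i (m : ℤ)) (Pi.single j (n : ℤ)) := by
  have hinj : Function.Injective fun q : ℕ × ℕ =>
      (Pi.single j (q.2 : ℤ) - Pi.single i (q.1 : ℤ) : Fin d → ℤ) := by
    rintro ⟨m, n⟩ ⟨m', n'⟩ h
    have h1 := congrFun h i
    have h2 := congrFun h j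
    simp [hij] at h1
    simp [hij.symm] at h2
    simp [h1, h2]
  -- By translation, the pair `(m, n)` contributes the probability that 0 is joined to a difference
  -- vector. These vectors are distinct, so the total is at most the expected cluster size of 0.
  have hsum : ∑' q : ℕ × ℕ, bondMeasure d p
      (conn (Pi.single i (q.1 : ℤ)) (Pi.single j (q.2 : ℤ))) ≠ ⊤ := by
    refine ne_top_of_le_ne_top (tsum_measure_conn_ne_top hp 0) ?_
    refine le_trans (le_of_eq (tsum_congr fun q => ?_)) (ENNReal.tsum_comp_le_tsum_of_injective hinj
      fun z => bondMeasure d p (conn 0 z))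
    have := measure_conn_add p (Pi.single i (q.1 : ℤ)) 0
      (Pi.single j (q.2 : ℤ) - Pi.single i (q.1 : ℤ))
    rwa [zero_add, sub_add_cancel] at this
  -- Borel–Cantelli leaves finitely many connected pairs; bounding their first coordinates is
  -- enough.
  filter_upwards [ae_finite_setOfPred_mem hsum] with ω hω
  obtain ⟨N, hN⟩ := (hω.image Prod.fst).bddAbove
  refine ⟨N + 1, fun m hm n _ h => ?_⟩
  have := hN ⟨(m, n), h, rfl⟩
  dsimp only at this
  omega

/-! ### Duality of facets, cuts and their boundaries -/

theorem Facet.points_subset_iff {F G : Facet d} : F.points ⊆ G.points ↔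
    ∀ i, (i ∈ F.dirs → i ∈ G.dirs ∧ F.base i = G.base i) ∧
      (i ∉ F.dirs → F.base i = G.base i ∨ i ∈ G.dirs ∧ F.base i = G.base i + 1) := by
  constructor
  · intro h i
    have h0 := h (show F.base ∈ F.points from fun _ => .inl rfl) i
    refine ⟨fun hi => ?_, fun _ => h0⟩
    have hmem : F.base + Pi.single i 1 ∈ F.points := by
      intro l
      by_cases hl : l = i
      · subst hl; simp [hi]
      · simp [hl]
    have h1 := h hmem i
    simp only [Pi.add_apply, Pi.single_eq_same] at h1
    rcases h1 with h1 | ⟨hG, h1⟩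
    · rcases h0 with h0 | ⟨-, h0⟩ <;> omega
    · exact ⟨hG, add_right_cancel h1⟩
  · intro h z hz i
    have hi := h i
    rcases hz i with hzi | ⟨hmem, hzi⟩
    · rw [hzi]
      by_cases hF : i ∈ F.dirs
      · exact .inl (hi.1 hF).2
      · exact hi.2 hF
    · exact .inr ⟨(hi.1 hmem).1, by rw [hzi, (hi.1 hmem).2]⟩

theorem Facet.exists_dual_eq (F : Facet d) : ∃ G : Facet d, G.dual = F := by
  refine ⟨⟨fun i => if i ∈ F.dirs then F.base i + 1 else F.base i, F.dirsᶜ⟩, ?_⟩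
  ext i
  · by_cases hi : i ∈ F.dirs <;> simp [Facet.dual, hi]
  · simp [Facet.dual]

theorem Facet.dual_points_subset_iff {F G : Facet d} :
    F.dual.points ⊆ G.dual.points ↔ G.points ⊆ F.points := by
  simp only [Facet.points_subset_iff, Facet.dual, Finset.mem_compl]
  refine forall_congr' fun i => ?_
  by_cases hF : i ∈ F.dirs <;> by_cases hG : i ∈ G.dirs <;> simp only [hF, hG] <;> grind

/-- Duality reverses inclusions, and the dimension gap excludes the opposite inclusion. It turns
incidence of a `(d-2)`-facet and a plaquette into inclusion of an edge in a unit square. -/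
theorem Facet.dual_incident_iff {F G : Facet d} (h : G.dim < F.dim) :
    F.dual.Incident G.dual ↔ G.points ⊆ F.points := by
  have hF := F.dim_dual_add_dim
  have hG := G.dim_dual_add_dim
  rw [Facet.Incident, Facet.dual_points_subset_iff, Facet.dual_points_subset_iff]
  refine ⟨fun h' => h'.2.resolve_right fun hsub => ?_, fun h' => ⟨by omega, .inl h'⟩⟩
  exact h.not_ge (Finset.card_le_card fun i hi => ((Facet.points_subset_iff.1 hsub i).1 hi).1)

theorem Facet.dual_injective : Function.Injective (Facet.dual (d := d)) := by
  intro F G h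
  have hd : F.dirs = G.dirs := compl_injective (congrArg Facet.dirs h)
  ext i
  · have := congrFun (congrArg Facet.base h) i
    simp only [Facet.dual, hd] at this
    split_ifs at this <;> omega
  · rw [hd]

theorem dualPlaquette_injective : Function.Injective (dualPlaquette (d := d)) :=
  fun _ _ h => Subtype.ext (Facet.dual_injective (congrArg Subtype.val h))

/-- The edge from `x` to `x + e_k`. -/
def mkEdge (x : Fin d → ℤ) (k : Fin d) : Edge d := ⟨⟨x, {k}⟩, by simp [Facet.dim]⟩

theorem mkEdge_injective :
    Function.Injective fun q : (Fin d → ℤ) × Fin d => mkEdge q.1 q.2 := by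
  rintro ⟨x, k⟩ ⟨y, l⟩ h
  simpa [mkEdge] using h

theorem exists_mkEdge_eq (e : Edge d) : ∃ k, e = mkEdge (Edge.src e) k := by
  obtain ⟨k, hk⟩ := Edge.exists_dirs_eq e
  exact ⟨k, Subtype.ext (Facet.ext rfl hk)⟩

theorem tgt_mkEdge (x : Fin d → ℤ) (k : Fin d) : Edge.tgt (mkEdge x k) = x + Pi.single k 1 := by
  ext i
  simp [Edge.tgt, mkEdge, Pi.single_apply]

theorem mkEdge_points_subset_iff {x s : Fin d → ℤ} {i j k : Fin d} (hij : i ≠ j) :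
    (mkEdge x k).1.points ⊆ (Facet.mk s {i, j}).points ↔
      (x, k) = (s, i) ∨ (x, k) = (s + Pi.single j 1, i) ∨ (x, k) = (s, j) ∨
        (x, k) = (s + Pi.single i 1, j) := by
  simp only [Facet.points_subset_iff, mkEdge, Finset.mem_singleton, Finset.mem_insert,
    Prod.mk.injEq, funext_iff, Pi.add_apply, Pi.single_apply]
  constructor
  · intro h
    rcases ((h k).1 rfl).1 with rfl | rfl
    · rcases (h j).2 hij.symm with hj | ⟨-, hj⟩
      · refine .inl ⟨fun l => ?_, rfl⟩
        have := h l
        grind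
      · refine .inr (.inl ⟨fun l => ?_, rfl⟩)
        have := h l
        grind
    · rcases (h i).2 hij with hi | ⟨-, hi⟩
      · refine .inr (.inr (.inl ⟨fun l => ?_, rfl⟩))
        have := h l
        grind
      · refine .inr (.inr (.inr ⟨fun l => ?_, rfl⟩))
        have := h l
        grind
  · grind

/-- The plaquettes dual to the edges of the edge boundary of a set of vertices. -/
def cut (A : Set (Fin d → ℤ)) : Set (Plaquette d) :=
  {π | ∃ e, dualPlaquette e = π ∧ ¬(Edge.src e ∈ A ↔ Edge.tgt e ∈ A)}

theorem dualPlaquette_mkEdge_mem_cut {A : Set (Fin d → ℤ)} {x : Fin d → ℤ} {k : Fin d} :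
    dualPlaquette (mkEdge x k) ∈ cut A ↔ ¬(x ∈ A ↔ x + Pi.single k 1 ∈ A) := by
  constructor
  · rintro ⟨e, he, h⟩
    rw [dualPlaquette_injective he, tgt_mkEdge] at h
    exact h
  · intro h
    exact ⟨_, rfl, by rwa [tgt_mkEdge]⟩

theorem incident_dualPlaquette_mkEdge_iff {x s : Fin d → ℤ} {i j k : Fin d} (hij : i ≠ j) :
    (Facet.mk s {i, j}).dual.Incident (dualPlaquette (mkEdge x k)).1 ↔
      (x, k) = (s, i) ∨ (x, k) = (s + Pi.single j 1, i) ∨ (x, k) = (s, j) ∨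
        (x, k) = (s + Pi.single i 1, j) := by
  rw [← mkEdge_points_subset_iff hij]
  exact Facet.dual_incident_iff (by rw [(mkEdge x k).2]; simp [Facet.dim, hij])

/-- A `(d-2)`-facet is dual to a unit square, and its incident plaquettes are dual to the four
sides. Around this 4-cycle, membership in `A` changes an even number of times. -/
theorem boundary_cut (A : Set (Fin d → ℤ)) : boundary (cut A) = ∅ := by
  classical
  rw [Set.eq_empty_iff_forall_notMem]
  rintro f ⟨hf, hodd⟩
  obtain ⟨G, rfl⟩ := f.exists_dual_eq
  have hG : G.dirs.card = 2 := by
    have := G.dim_dual_add_dim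
    rw [Facet.dim] at this hf
    simp only [Facet.dim] at this
    omega
  obtain ⟨i, j, hij, hdirs⟩ := Finset.card_eq_two.1 hG
  obtain ⟨s, dirs⟩ := G
  dsimp only at hdirs
  subst hdirs
  let T : Finset ((Fin d → ℤ) × Fin d) :=
    {(s, i), (s + Pi.single j 1, i), (s, j), (s + Pi.single i 1, j)}
  have hset : {π | π ∈ cut A ∧ (Facet.mk s {i, j}).dual.Incident π.1} =
      (fun q : (Fin d → ℤ) × Fin d => dualPlaquette (mkEdge q.1 q.2)) ''
        (T.filter fun q => ¬(q.1 ∈ A ↔ q.1 + Pi.single q.2 1 ∈ A) : Finset _) := by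
    ext π
    constructor
    · rintro ⟨⟨e, rfl, he⟩, hinc⟩
      obtain ⟨k, hk⟩ := exists_mkEdge_eq e
      rw [hk] at hinc he
      rw [incident_dualPlaquette_mkEdge_iff hij] at hinc
      rw [tgt_mkEdge] at he
      refine ⟨(Edge.src e, k), Finset.mem_coe.2 (Finset.mem_filter.2 ⟨?_, he⟩), ?_⟩
      · simpa only [T, Finset.mem_insert, Finset.mem_singleton] using hinc
      · dsimp only
        rw [← hk]
    · rintro ⟨⟨x, k⟩, hq, rfl⟩
      obtain ⟨hT, hA⟩ := Finset.mem_filter.1 (Finset.mem_coe.1 hq)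
      refine ⟨dualPlaquette_mkEdge_mem_cut.2 hA, (incident_dualPlaquette_mkEdge_iff hij).2 ?_⟩
      simpa only [T, Finset.mem_insert, Finset.mem_singleton] using hT
  have hinj : Function.Injective fun q : (Fin d → ℤ) × Fin d => dualPlaquette (mkEdge q.1 q.2) :=
    dualPlaquette_injective.comp mkEdge_injective
  rw [hset, Set.ncard_image_of_injective _ hinj, Set.ncard_coe_finset, Finset.card_filter] at hodd
  have hne (k : Fin d) : s ≠ s + Pi.single k 1 := fun h => by simpa using congrFun h k
  rw [Finset.sum_insert (by simp [hij]), Finset.sum_insert (by simp [hij]),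
    Finset.sum_insert (by simp), Finset.sum_singleton,
    add_right_comm s (Pi.single j 1) (Pi.single i 1)] at hodd
  revert hodd
  by_cases h1 : s ∈ A <;> by_cases h2 : s + Pi.single i 1 ∈ A <;>
    by_cases h3 : s + Pi.single j 1 ∈ A <;>
    by_cases h4 : s + Pi.single i 1 + Pi.single j 1 ∈ A <;> simp [h1, h2, h3, h4] <;> decide

/-! ### Components of a cut and the infinite interface -/

/-- Adjacency of plaquettes of a set `D`. -/
def adjIn (D : Set (Plaquette d)) : SimpleGraph (Plaquette d) where
  Adj x y := (plaquetteGraph d).Adj x y ∧ x ∈ D ∧ y ∈ D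
  symm := ⟨fun _ _ h => ⟨h.1.symm, h.2.2, h.2.1⟩⟩
  loopless := ⟨fun _ h => h.1.ne rfl⟩

/-- The connected component of `π` in `D`. -/
def componentIn (D : Set (Plaquette d)) (π : Plaquette d) : Set (Plaquette d) :=
  {π' | (adjIn D).Reachable π π'}

theorem componentIn_subset {D : Set (Plaquette d)} {π : Plaquette d} (h : π ∈ D) :
    componentIn D π ⊆ D :=
  fun _ h' => mem_of_reachable (G := adjIn D) (fun _ _ _ h => h.2.2) h h'

/-- A component of a set with empty boundary is a surface. -/
theorem isSurface_componentIn {D : Set (Plaquette d)} (hD : boundary D = ∅) {π : Plaquette d}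
    (h : π ∈ D) : IsSurface (componentIn D π) := by
  constructor
  · have hsupp : ((adjIn D).connectedComponentMk π).supp = componentIn D π := by
      ext x
      rw [SimpleGraph.ConnectedComponent.mem_supp_iff, SimpleGraph.ConnectedComponent.eq]
      exact ⟨fun h => h.symm, fun h => h.symm⟩
    have hc : ((adjIn D).induce (componentIn D π)).Connected :=
      hsupp ▸ ((adjIn D).connectedComponentMk π).connected_toSimpleGraph
    refine hc.mono (SimpleGraph.comap_monotone _ ?_)
    exact fun _ _ hxy => hxy.1
  · rw [Set.eq_empty_iff_forall_notMem]
    rintro f ⟨hf, hodd⟩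
    obtain ⟨π₁, hπ₁, hinc₁⟩ := Set.nonempty_of_ncard_ne_zero fun h0 => by
      rw [h0] at hodd
      exact absurd hodd (by decide)
    -- Any plaquette of `D` incident to `f` equals or is adjacent to `π₁`, so around `f` the
    -- component and all of `D` coincide.
    refine Set.eq_empty_iff_forall_notMem.1 hD f ⟨hf, ?_⟩
    convert hodd using 3
    ext π₂
    refine and_congr_left fun hinc₂ => ⟨fun h₂ => ?_, fun h₂ => componentIn_subset h h₂⟩
    by_cases hne : π₁ = π₂
    · exact hne ▸ hπ₁
    · have hadj : (adjIn D).Adj π₁ π₂ :=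
        ⟨⟨hne, f, hf, hinc₁, hinc₂⟩, componentIn_subset h hπ₁, h₂⟩
      exact SimpleGraph.Reachable.trans hπ₁ hadj.reachable

/-- A discrete Stokes formula on a square grid. -/
theorem sum_square_eq {R : Type*} [AddCommGroup R] {f g : ℕ → ℕ → R}
    (h : ∀ m n, f m n + g (m + 1) n = g m n + f m (n + 1)) (M N : ℕ) :
    ∑ m ∈ Finset.range M, f m 0 + ∑ n ∈ Finset.range N, g M n =
      ∑ n ∈ Finset.range N, g 0 n + ∑ m ∈ Finset.range M, f m N := by
  have hrow (m : ℕ) : f m 0 + ∑ n ∈ Finset.range N, g (m + 1) n =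
      ∑ n ∈ Finset.range N, g m n + f m N := by
    induction N with
    | zero => simp
    | succ N ih =>
      rw [Finset.sum_range_succ, Finset.sum_range_succ, ← add_assoc, ih, add_assoc, h]
      abel
  induction M with
  | zero => simp
  | succ M ih =>
    rw [Finset.sum_range_succ, Finset.sum_range_succ, add_assoc, hrow, add_left_comm, ← add_assoc,
      add_comm (∑ n ∈ Finset.range N, g M n), ih]
    abel

/-- If `A` contains the tail of a coordinate ray and its complement contains the tail of another
one, then the cut of `A` has an infinite component. -/
theorem exists_infinite_componentIn_cut {A : Set (Fin d → ℤ)} {i j : Fin d} (hij : i ≠ j) {N : ℕ}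
    (hi : ∀ n ≥ N, (Pi.single i (n : ℤ) : Fin d → ℤ) ∈ A)
    (hj : ∀ n ≥ N, (Pi.single j (n : ℤ) : Fin d → ℤ) ∉ A) :
    ∃ π ∈ cut A, (componentIn (cut A) π).Infinite := by
  classical
  by_contra! hfin
  let pt (m n : ℕ) : Fin d → ℤ := Pi.single i (m : ℤ) + Pi.single j (n : ℤ)
  have hpt1 (m n : ℕ) : pt m n + Pi.single i 1 = pt (m + 1) n := by
    simp only [pt, Nat.cast_add, Nat.cast_one, Pi.single_add]
    abel
  have hpt2 (m n : ℕ) : pt m n + Pi.single j 1 = pt m (n + 1) := by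
    simp only [pt, Nat.cast_add, Nat.cast_one, Pi.single_add]
    abel
  have hAi : ∀ m ≥ N, pt m 0 ∈ A := fun m hm => by simpa [pt] using hi m hm
  have hAj : ∀ n ≥ N, pt 0 n ∉ A := fun n hn => by simpa [pt] using hj n hn
  let P (m n : ℕ) (k : Fin d) : Plaquette d := dualPlaquette (mkEdge (pt m n) k)
  let X : Set (Plaquette d) := cut A ∩
    ((fun m => P m 0 i) '' Set.Iio N ∪ (fun n => P 0 n j) '' Set.Iio N)
  -- `U` gathers the components of the cut that cross one of the two half-axes. Beyond `N` neither
  -- is crossed, so finitely many components suffice and `U` is finite by assumption.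
  let U : Set (Plaquette d) := ⋃ π ∈ X, componentIn (cut A) π
  have hUfin : U.Finite := by
    refine Set.Finite.biUnion ?_ fun π hπ => hfin π hπ.1
    exact ((((Set.finite_Iio N).image _).union ((Set.finite_Iio N).image _))).inter_of_right _
  have hUcut : U ⊆ cut A := Set.iUnion₂_subset fun π hπ => componentIn_subset hπ.1
  have hXU : X ⊆ U := fun π hπ => Set.mem_biUnion hπ (SimpleGraph.Reachable.refl π)
  have hUi (m : ℕ) : P m 0 i ∈ U ↔ P m 0 i ∈ cut A := by
    refine ⟨fun h => hUcut h, fun h => hXU ⟨h, .inl ⟨m, ?_, rfl⟩⟩⟩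
    by_contra hm
    rw [Set.mem_Iio, not_lt] at hm
    rw [dualPlaquette_mkEdge_mem_cut, hpt1] at h
    exact h (iff_of_true (hAi m hm) (hAi (m + 1) (by omega)))
  have hUj (n : ℕ) : P 0 n j ∈ U ↔ P 0 n j ∈ cut A := by
    refine ⟨fun h => hUcut h, fun h => hXU ⟨h, .inr ⟨n, ?_, rfl⟩⟩⟩
    by_contra hn
    rw [Set.mem_Iio, not_lt] at hn
    rw [dualPlaquette_mkEdge_mem_cut, hpt2] at h
    exact h (iff_of_false (hAj n hn) (hAj (n + 1) (by omega)))
  have hUclosed {π π' : Plaquette d} {f : Facet d} (hf : f.dim + 2 = d) (h : π ∈ U)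
      (hinc : f.Incident π.1) (hinc' : f.Incident π'.1) : π' ∈ U ↔ π' ∈ cut A := by
    refine ⟨fun h => hUcut h, fun h' => ?_⟩
    by_cases hne : π = π'
    · exact hne ▸ h
    · simp only [U, Set.mem_iUnion] at h ⊢
      obtain ⟨π₀, hπ₀, hr⟩ := h
      have hadj : (adjIn (cut A)).Adj π π' :=
        ⟨⟨hne, f, hf, hinc, hinc'⟩, componentIn_subset hπ₀.1 hr, h'⟩
      exact ⟨π₀, hπ₀, SimpleGraph.Reachable.trans hr hadj.reachable⟩
  let a (m n : ℕ) : ZMod 2 := if pt m n ∈ A then 1 else 0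
  let f (m n : ℕ) : ZMod 2 := if P m n i ∈ U then 1 else 0
  let g (m n : ℕ) : ZMod 2 := if P m n j ∈ U then 1 else 0
  have hf_eq {m n : ℕ} (h : P m n i ∈ U ↔ P m n i ∈ cut A) : f m n = a m n + a (m + 1) n := by
    rw [dualPlaquette_mkEdge_mem_cut, hpt1] at h
    simp only [f, a, h]
    by_cases h1 : pt m n ∈ A <;> by_cases h2 : pt (m + 1) n ∈ A <;> simp [h1, h2]
    decide
  have hg_eq {m n : ℕ} (h : P m n j ∈ U ↔ P m n j ∈ cut A) : g m n = a m n + a m (n + 1) := by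
    rw [dualPlaquette_mkEdge_mem_cut, hpt2] at h
    simp only [g, a, h]
    by_cases h1 : pt m n ∈ A <;> by_cases h2 : pt m (n + 1) ∈ A <;> simp [h1, h2]
    decide
  -- At each square, either no side is dual to a plaquette of `U`, or `U` contains every cut
  -- plaquette there; in both cases the sum around the square vanishes mod 2.
  have hsquare (m n : ℕ) : f m n + g (m + 1) n = g m n + f m (n + 1) := by
    have hdim : (Facet.mk (pt m n) {i, j}).dual.dim + 2 = d := by
      have := (Facet.mk (pt m n) {i, j}).dim_dual_add_dim
      rwa [show (Facet.mk (pt m n) {i, j}).dim = 2 by simp [Facet.dim, hij]] at this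
    have hinc (x : Fin d → ℤ) (k : Fin d) := incident_dualPlaquette_mkEdge_iff
      (x := x) (s := pt m n) (k := k) hij
    have h1 : (Facet.mk (pt m n) {i, j}).dual.Incident (P m n i).1 := (hinc _ _).2 (.inl rfl)
    have h2 : (Facet.mk (pt m n) {i, j}).dual.Incident (P m (n + 1) i).1 :=
      (hinc _ _).2 (.inr (.inl (by rw [hpt2])))
    have h3 : (Facet.mk (pt m n) {i, j}).dual.Incident (P m n j).1 :=
      (hinc _ _).2 (.inr (.inr (.inl rfl)))
    have h4 : (Facet.mk (pt m n) {i, j}).dual.Incident (P (m + 1) n j).1 :=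
      (hinc _ _).2 (.inr (.inr (.inr (by rw [hpt1]))))
    by_cases hU : P m n i ∈ U ∨ P m (n + 1) i ∈ U ∨ P m n j ∈ U ∨ P (m + 1) n j ∈ U
    · obtain ⟨π, hπ, hπinc⟩ : ∃ π ∈ U, (Facet.mk (pt m n) {i, j}).dual.Incident π.1 := by
        rcases hU with h | h | h | h
        exacts [⟨_, h, h1⟩, ⟨_, h, h2⟩, ⟨_, h, h3⟩, ⟨_, h, h4⟩]
      rw [hf_eq (hUclosed hdim hπ hπinc h1), hf_eq (hUclosed hdim hπ hπinc h2),
        hg_eq (hUclosed hdim hπ hπinc h3), hg_eq (hUclosed hdim hπ hπinc h4)]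
      linear_combination (CharTwo.add_self_eq_zero (a (m + 1) n) -
        CharTwo.add_self_eq_zero (a m (n + 1)))
    · simp only [not_or] at hU
      simp [f, g, hU]
  have htel1 (M : ℕ) : ∑ m ∈ Finset.range M, f m 0 = a 0 0 + a M 0 := by
    induction M with
    | zero => exact (CharTwo.add_self_eq_zero _).symm
    | succ M ih =>
      rw [Finset.sum_range_succ, ih, hf_eq (hUi M)]
      linear_combination CharTwo.add_self_eq_zero (a M 0)
  have htel2 (M : ℕ) : ∑ n ∈ Finset.range M, g 0 n = a 0 0 + a 0 M := by
    induction M with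
    | zero => exact (CharTwo.add_self_eq_zero _).symm
    | succ M ih =>
      rw [Finset.sum_range_succ, ih, hg_eq (hUj M)]
      linear_combination CharTwo.add_self_eq_zero (a 0 M)
  obtain ⟨B₁, hB₁⟩ := (hUfin.image fun π => π.1.base i).bddAbove
  obtain ⟨B₂, hB₂⟩ := (hUfin.image fun π => π.1.base j).bddAbove
  -- Large enough that the far sides of the grid miss `U`. The `+ 2` absorbs the shift of the dual
  -- base by `-1` and makes the inequality strict.
  let M := max N (max (B₁.toNat + 2) (B₂.toNat + 2))
  have hgM (n : ℕ) : g M n = 0 := by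
    refine if_neg fun h => ?_
    have := hB₁ ⟨_, h, rfl⟩
    simp only [P, dualPlaquette, Facet.dual, mkEdge, pt, Finset.mem_singleton, hij, if_false,
      Pi.add_apply, Pi.single_eq_same, Pi.single_eq_of_ne hij] at this
    omega
  have hfM (m : ℕ) : f m M = 0 := by
    refine if_neg fun h => ?_
    have := hB₂ ⟨_, h, rfl⟩
    simp only [P, dualPlaquette, Facet.dual, mkEdge, pt, Finset.mem_singleton, hij.symm, if_false,
      Pi.add_apply, Pi.single_eq_same, Pi.single_eq_of_ne hij.symm] at this
    omega
  -- With the far sides zero, Stokes equates the crossings of the two half-axes mod 2, so `a M 0 = a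
  -- 0 M`, although one corner is in `A` and the other is not.
  have hgrid := sum_square_eq hsquare M M
  simp only [hgM, hfM, Finset.sum_const_zero, add_zero, htel1, htel2] at hgrid
  have h1 : a M 0 = 1 := if_pos (hAi M (le_max_left _ _))
  have h2 : a 0 M = 0 := if_neg (hAj M (le_max_left _ _))
  rw [h1, h2] at hgrid
  exact one_ne_zero (add_left_cancel hgrid)

/-! ### Conclusion -/

/-- If the tails of two coordinate rays are not connected by open paths, then there is an infinite
open surface. -/
theorem hasInfiniteOpenSurface_of_rays {ω : Config d} {i j : Fin d} (hij : i ≠ j) {N : ℕ}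
    (h : ∀ m ≥ N, ∀ n ≥ N,
      ¬ (openGraph ω).Reachable (Pi.single i (m : ℤ)) (Pi.single j (n : ℤ))) :
    HasInfiniteOpenSurface ω := by
  let A : Set (Fin d → ℤ) := {x | ∃ m ≥ N, (openGraph ω).Reachable (Pi.single i (m : ℤ)) x}
  obtain ⟨π, hπ, hinf⟩ := exists_infinite_componentIn_cut (A := A) (N := N) hij
    (fun n hn => ⟨n, hn, .refl _⟩) (fun n hn ⟨m, hm, hr⟩ => h m hm n hn hr)
  refine ⟨_, hinf, isSurface_componentIn (boundary_cut A) hπ, fun π' hπ' => ?_⟩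
  obtain ⟨e, he, hA⟩ := componentIn_subset hπ hπ'
  -- `A` is a union of open clusters, so an edge with exactly one end in `A` cannot be open.
  refine ⟨e, he, Bool.eq_false_iff.2 fun hopen => hA ?_⟩
  have hadj : (openGraph ω).Adj (Edge.src e) (Edge.tgt e) := openGraph_adj.2 ⟨e, hopen, rfl⟩
  exact ⟨fun ⟨m, hm, hr⟩ => ⟨m, hm, hr.trans hadj.reachable⟩,
    fun ⟨m, hm, hr⟩ => ⟨m, hm, hr.trans hadj.symm.reachable⟩⟩

theorem ae_hasInfiniteOpenSurface (hd : 2 ≤ d) {p : unitInterval} (hp : (p : ℝ) < pc d) :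
    ∀ᵐ ω ∂bondMeasure d p, HasInfiniteOpenSurface ω := by
  have hij : (⟨0, by omega⟩ : Fin d) ≠ ⟨1, by omega⟩ := by simp
  filter_upwards [ae_exists_rays_not_connected hp hij] with ω ⟨N, hN⟩
  exact hasInfiniteOpenSurface_of_rays hij hN

theorem pc_le_psurf (hd : 2 ≤ d) : pc d ≤ psurf d := by
  by_contra! hlt
  obtain ⟨q, hq, hqc⟩ := exists_between hlt
  -- This also covers an empty defining set, whose real supremum is 0; it ensures that `q` is a
  -- valid parameter.
  have h0 : 0 ≤ psurf d := Real.sSup_nonneg (by rintro _ ⟨q, rfl, -⟩; exact q.2.1)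
  have hq01 : q ∈ Set.Icc (0 : ℝ) 1 := ⟨h0.trans hq.le, hqc.le.trans (pc_le_one d)⟩
  have hbdd : BddAbove {p : ℝ | ∃ q : unitInterval, (q : ℝ) = p ∧
      ∀ᵐ ω ∂bondMeasure d q, HasInfiniteOpenSurface ω} :=
    ⟨1, by rintro _ ⟨q, rfl, -⟩; exact q.2.2⟩
  exact hq.not_ge (le_csSup hbdd
    ⟨⟨q, hq01⟩, rfl, ae_hasInfiniteOpenSurface hd (p := ⟨q, hq01⟩) hqc⟩)

end PlaquettePercolation

theorem mainTheorem5 (d : ℕ) (hd : 3 ≤ d) :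
    PlaquettePercolation.pc d ≤ PlaquettePercolation.psurf d ∧
      ∀ p : unitInterval, (p : ℝ) < PlaquettePercolation.pc d →
        ∀ᵐ ω ∂(PlaquettePercolation.bondMeasure d p),
          PlaquettePercolation.HasInfiniteOpenSurface ω :=
  ⟨PlaquettePercolation.pc_le_psurf (by omega), fun _ hp =>
    PlaquettePercolation.ae_hasInfiniteOpenSurface (by omega) hp⟩
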